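/- Let $l\ge 1$ and $n,m\ge 2$ be integers and put $|N|:=l+n+m$. On $\mathbb C^k$ write $a\bullet b:=\sum_i a_ib_i$ and $|a|:=\sqrt{a\bullet\overline a}$. Let $$\mathbb H_N:=\{(x,z,w)\in\mathbb C^l\times(\mathbb C^{n+1}\setminus\{0\})\times(\mathbb C^{m+1}\setminus\{0\}) : z\bullet z=w\bullet w=0\},$$ let $\mathbb M_N$ be the intersection of $\mathbb H_N$ with the open Euclidean unit ball of $\mathbb C^{|N|+2}$, and let $dV$ be the canonical (Riemannian) volume measure of the complex manifold $\mathbb H_N\subset\mathbb C^{|N|+2}$. Write $\Theta=(\xi,\zeta,\eta)$ and $Z=(x,z,w)$. Fix complex constants $c_1,\dots,c_{|N|+2}$ and define the coefficients of the Martinelli–Bochner kernel by $$B_k(\Theta,Z):=c_k(\overline{\xi_k}-\overline{x_k})(|\zeta|^2+z\bullet\overline\zeta)(|\eta|^2+w\bullet\overline\eta)\quad(1\le k\le l),$$ $$B_{l+j}(\Theta,Z):=c_{l+j}\left((\overline{z_j}-\overline{\zeta_j})(z\bullet\overline\zeta+|\zeta|^2)-(z_j+\zeta_j)\overline{z\bullet(\zeta-z)}\right)(|\eta|^2+w\bullet\overline\eta)\quad(1\le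 j\le n+1),$$ $$B_{l+n+1+i}(\Theta,Z):=c_{l+n+1+i}\left((\overline{w_i}-\overline{\eta_i})(w\bullet\overline\eta+|\eta|^2)-(w_i+\eta_i)\overline{w\bullet(\eta-w)}\right)(|\zeta|^2+z\bullet\overline\zeta)\quad(1\le i\le m+1),$$ and set $$\Delta(\Theta,Z,Z'):=\frac1{|\zeta|^2|\eta|^2}\sum_{k=1}^{|N|+2}\left|\frac{B_k(\Theta,Z)}{|\Theta-Z|^{2|N|}}-\frac{B_k(\Theta,Z')}{|\Theta-Z'|^{2|N|}}\right|.$$ **Theorem 7.2.** Let $q$ be a real number with $1\le q<\frac{2|N|+4}{2|N|+3}$. Then there is a constant $C>0$, depending only on $l,n,m$, $q$ and the constants $c_k$, such that for all $Z,Z'\in\mathbb M_N$ $$\int_{\mathbb M_N}\Delta(\Theta,Z,Z')^q\left(\frac{|\zeta|\,|\eta|}{|\zeta_{n+1}|\,|\eta_{m+1}|}\right)^{2(q-1)}dV(\Theta)\le\begin{cases}C\,|Z-Z'|^{2|N|+4-(2|N|+3)q}&\text{if }q>1,\\ C\,|Z-Z'|\left(1+\bigl|\log|Z-Z'|\bigr|\right)&\text{if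 }q=1,\end{cases}$$ where the right-hand side is $0$ if $Z=Z'$. -/

import Mathlib

open MeasureTheory

noncomputable section

namespace MartinelliBochner

/-- The bilinear (not sesquilinear) product `a • b = ∑ᵢ aᵢ bᵢ` on `ℂᵏ`. -/
def bdot {k : ℕ} (a b : EuclideanSpace ℂ (Fin k)) : ℂ := ∑ i, a i * b i

/-- Coordinatewise complex conjugation on `ℂᵏ`. -/
def conjVec {k : ℕ} (a : EuclideanSpace ℂ (Fin k)) : EuclideanSpace ℂ (Fin k) :=
  WithLp.toLp 2 fun i => (starRingEnd ℂ) (a i)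

/-- The index set of the `l + (n+1) + (m+1) = |N| + 2` coordinates. -/
abbrev Idx (l n m : ℕ) : Type := Fin l ⊕ (Fin (n + 1) ⊕ Fin (m + 1))

/-- The ambient space `ℂˡ × ℂⁿ⁺¹ × ℂᵐ⁺¹` with its Euclidean norm. -/
abbrev Amb (l n m : ℕ) : Type := EuclideanSpace ℂ (Idx l n m)

variable {l n m : ℕ}

/-- The component in `ℂˡ` (written `x`, or `ξ` for the point `Θ`). -/
def xPart (Z : Amb l n m) : EuclideanSpace ℂ (Fin l) :=
  WithLp.toLp 2 fun i => Z (Sum.inl i)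

/-- The component in `ℂⁿ⁺¹` (written `z`, or `ζ` for the point `Θ`). -/
def zPart (Z : Amb l n m) : EuclideanSpace ℂ (Fin (n + 1)) :=
  WithLp.toLp 2 fun i => Z (Sum.inr (Sum.inl i))

/-- The component in `ℂᵐ⁺¹` (written `w`, or `η` for the point `Θ`). -/
def wPart (Z : Amb l n m) : EuclideanSpace ℂ (Fin (m + 1)) :=
  WithLp.toLp 2 fun i => Z (Sum.inr (Sum.inr i))

variable (l n m) in
/-- The complex manifold `ℍ_N`: points `(x, z, w)` with `z ≠ 0`, `w ≠ 0`, `z • z = w • w = 0`. -/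
def HN : Set (Amb l n m) :=
  {Z | zPart Z ≠ 0 ∧ wPart Z ≠ 0 ∧ bdot (zPart Z) (zPart Z) = 0 ∧ bdot (wPart Z) (wPart Z) = 0}

variable (l n m) in
/-- The manifold `𝕄_N`: the part of `ℍ_N` in the open Euclidean unit ball. -/
def MN : Set (Amb l n m) := HN l n m ∩ Metric.ball 0 1

variable (l n m) in
/-- The canonical measure `dV` of the complex manifold `ℍ_N` (complex dimension `l + n + m`), i.e.
the Riemannian volume of the metric induced by the Euclidean metric of the ambient space. For an
embedded submanifold of real dimension `d` it is the `d`-dimensional Hausdorff measure, normalized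
to agree with Lebesgue measure on `ℝᵈ`. It is seen here as a measure on the ambient space. -/
def dV : Measure (Amb l n m) := (μHE[2 * (l + n + m)]).restrict (HN l n m)

/-- The factor `|ζ|² + z • ζ̄`, for `z, ζ ∈ ℂᵏ`. -/
def fac {k : ℕ} (ζ z : EuclideanSpace ℂ (Fin k)) : ℂ :=
  (‖ζ‖ : ℂ) ^ 2 + bdot z (conjVec ζ)

/-- The `j`-th component `(z̄ⱼ - ζ̄ⱼ)(z • ζ̄ + |ζ|²) - (zⱼ + ζⱼ) conj(z • (ζ - z))`. -/
def comp {k : ℕ} (ζ z : EuclideanSpace ℂ (Fin k)) (j : Fin k) : ℂ :=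
  ((starRingEnd ℂ) (z j) - (starRingEnd ℂ) (ζ j)) * (bdot z (conjVec ζ) + (‖ζ‖ : ℂ) ^ 2)
    - (z j + ζ j) * (starRingEnd ℂ) (bdot z (ζ - z))

/-- The polynomials `B_k(Θ, Z)` of the Martinelli–Bochner formula, with numerical factors `c k`. -/
def B (c : Idx l n m → ℂ) (Θ Z : Amb l n m) : Idx l n m → ℂ
  | Sum.inl k =>
      c (Sum.inl k) * ((starRingEnd ℂ) (xPart Θ k) - (starRingEnd ℂ) (xPart Z k))
        * fac (zPart Θ) (zPart Z) * fac (wPart Θ) (wPart Z)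
  | Sum.inr (Sum.inl j) =>
      c (Sum.inr (Sum.inl j)) * comp (zPart Θ) (zPart Z) j * fac (wPart Θ) (wPart Z)
  | Sum.inr (Sum.inr i) =>
      c (Sum.inr (Sum.inr i)) * comp (wPart Θ) (wPart Z) i * fac (zPart Θ) (zPart Z)

/-- `Δ(Θ, Z, Z')`: the difference of the Martinelli–Bochner kernels at `Z` and `Z'`. -/
def Δ (c : Idx l n m → ℂ) (Θ Z Z' : Amb l n m) : ℝ :=
  1 / (‖zPart Θ‖ ^ 2 * ‖wPart Θ‖ ^ 2) *
    ∑ j : Idx l n m,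
      ‖B c Θ Z j / ((‖Θ - Z‖ ^ (2 * (l + n + m)) : ℝ) : ℂ)
        - B c Θ Z' j / ((‖Θ - Z'‖ ^ (2 * (l + n + m)) : ℝ) : ℂ)‖

/-- `|ζ| |η| / (|ζₙ₊₁| |ηₘ₊₁|)`; the set where a denominator vanishes is `dV`-null. -/
def wt (Θ : Amb l n m) : ℝ :=
  (‖zPart Θ‖ * ‖wPart Θ‖) / (‖zPart Θ (Fin.last n)‖ * ‖wPart Θ (Fin.last m)‖)

end MartinelliBochner

end

/- On the isotropic cones `z • z = w • w = 0` each coefficient `B_k` at distance `ρ` from `Z` is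
`O(ρ |ζ| |η| (|ζ| + ρ) (|η| + ρ))`, because there `z • ζ = (z - ζ) • ζ` is small with `z - ζ`.
Divided by `|ζ|² |η|²`, the kernel is therefore at most `ρ ^ (1 - 2|N|)` times the pole weights
`(1 + ρ / |ζ|) (1 + ρ / |η|)`, and its difference at `Z` and `Z'` gains a factor `|Z - Z'| / ρ` once
`ρ ≥ 2 |Z - Z'|`. Forgetting one dominant coordinate of `z` and one of `w` gives charts of `ℍ_N`
that have Lipschitz inverses on sectors. They compare `dV` with Lebesgue measure and bound the
weighted integral of the `q`-th power of the pole weights over a ball of radius `ρ` by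
`O(ρ ^ (2|N| - 4(q - 1)))`. Near `Z` the kernels at `Z` and `Z'` are integrated separately; farther
away the difference estimate is summed over dyadic shells. This series is geometric with ratio
`2 ^ ((2|N| + 4)(1 - q))`, which degenerates at `q = 1` and produces the logarithm. -/

noncomputable section

namespace MartinelliBochner

section ProductIntegral

theorem lintegral_pi_fin_prod_eq_prod {k : ℕ} {E : Fin k → Type*} [∀ i, MeasurableSpace (E i)]
    (μ : ∀ i, Measure (E i)) [∀ i, SigmaFinite (μ i)] {f : ∀ i, E i → ENNReal}
    (hf : ∀ i, Measurable (f i)) :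
    ∫⁻ x, ∏ i, f i (x i) ∂Measure.pi μ = ∏ i, ∫⁻ x, f i x ∂μ i := by
  induction k with
  | zero => simp
  | succ k ih =>
    rw [← ((measurePreserving_piFinSuccAbove μ 0).symm).lintegral_comp (by fun_prop)]
    simp_rw [MeasurableEquiv.piFinSuccAbove_symm_apply, Fin.insertNthEquiv,
      Fin.prod_univ_succ, Fin.insertNth_zero, Equiv.coe_fn_mk, Fin.cons_succ, Fin.cons_zero]
    rw [← ih (fun i => μ i.succ) fun i => hf i.succ]
    have hg : Measurable fun x : ∀ i : Fin k, E i.succ => ∏ i, f i.succ (x i) :=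
      Finset.measurable_prod _ fun i _ => (hf i.succ).comp (measurable_pi_apply i)
    exact lintegral_prod_mul (μ := μ 0) (ν := Measure.pi fun i => μ i.succ)
      (hf 0).aemeasurable hg.aemeasurable

theorem lintegral_pi_prod_eq_prod {ι : Type*} [Fintype ι] {E : ι → Type*}
    [∀ i, MeasurableSpace (E i)] (μ : ∀ i, Measure (E i)) [∀ i, SigmaFinite (μ i)]
    {f : ∀ i, E i → ENNReal} (hf : ∀ i, Measurable (f i)) :
    ∫⁻ x, ∏ i, f i (x i) ∂Measure.pi μ = ∏ i, ∫⁻ x, f i x ∂μ i := by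
  let e := (Fintype.equivFin ι).symm
  rw [← (measurePreserving_piCongrLeft μ e).lintegral_comp (by fun_prop)]
  simp_rw [← e.prod_comp, MeasurableEquiv.coe_piCongrLeft, Equiv.piCongrLeft_apply_apply]
  exact lintegral_pi_fin_prod_eq_prod _ fun i => hf _

end ProductIntegral

section DyadicShells

open Set

theorem Ioo_zero_subset_iUnion_Ico {r : ℝ} (hr : 0 < r) :
    Ioo 0 r ⊆ ⋃ j : ℕ, Ico (r * (1 / 2) ^ j / 2) (r * (1 / 2) ^ j) := by
  intro t ht
  obtain ⟨k, hk⟩ := exists_mem_Ico_zpow (div_pos ht.1 hr) one_lt_two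
  have hk0 : k < 0 := by
    have h := hk.1.trans_lt ((div_lt_one hr).2 ht.2)
    rwa [← zpow_zero (2 : ℝ), zpow_lt_zpow_iff_right₀ one_lt_two] at h
  obtain ⟨j, rfl⟩ : ∃ j : ℕ, k = -(j : ℤ) - 1 := ⟨(-k - 1).toNat, by omega⟩
  rw [sub_add_cancel, zpow_sub_one₀ two_ne_zero, zpow_neg, zpow_natCast, ← inv_pow, mem_Ico,
    le_div_iff₀ hr, div_lt_iff₀ hr] at hk
  rw [mem_iUnion, one_div]
  exact ⟨j, by linarith [hk.1], by linarith [hk.2]⟩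

theorem Ico_mul_two_pow_subset_iUnion_Ico {r : ℝ} (hr : 0 < r) (M : ℕ) :
    Ico r (r * 2 ^ M) ⊆ ⋃ j : Fin M, Ico (2 * r * 2 ^ (j : ℕ) / 2) (2 * r * 2 ^ (j : ℕ)) := by
  intro t ht
  obtain ⟨j, hj, hj'⟩ := exists_nat_pow_near ((one_le_div hr).2 ht.1) one_lt_two
  have hjM : j < M := by
    rw [← pow_lt_pow_iff_right₀ (one_lt_two (α := ℝ))]
    exact hj.trans_lt ((div_lt_iff₀' hr).2 ht.2)
  rw [le_div_iff₀ hr] at hj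
  rw [div_lt_iff₀ hr, pow_succ] at hj'
  rw [mem_iUnion]
  refine ⟨⟨j, hjM⟩, ?_, ?_⟩ <;> dsimp only <;> linarith

theorem Ici_subset_iUnion_Ico {r : ℝ} (hr : 0 < r) :
    Ici r ⊆ ⋃ j : ℕ, Ico (2 * r * 2 ^ j / 2) (2 * r * 2 ^ j) := by
  intro t ht
  obtain ⟨M, hM⟩ := pow_unbounded_of_one_lt (t / r) one_lt_two
  have htM : t ∈ Ico r (r * 2 ^ M) := ⟨ht, (div_lt_iff₀' hr).1 hM⟩
  obtain ⟨j, hj⟩ := mem_iUnion.1 (Ico_mul_two_pow_subset_iUnion_Ico hr M htM)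
  exact mem_iUnion.2 ⟨j, hj⟩

variable {X : Type*} [MeasurableSpace X] {μ : Measure X} {D : X → ℝ} {Φ : X → ENNReal}
  {K : ENNReal} {r e : ℝ}

theorem setLIntegral_preimage_iUnion_shell_le {a : ℝ} (hr : 0 < r) (ha : 0 < a) (hae : a ^ e < 1)
    (H : ∀ j : ℕ, ∫⁻ x in D ⁻¹' Ico (r * a ^ j / 2) (r * a ^ j), Φ x ∂μ
      ≤ K * ENNReal.ofReal ((r * a ^ j) ^ e)) :
    ∫⁻ x in D ⁻¹' ⋃ j : ℕ, Ico (r * a ^ j / 2) (r * a ^ j), Φ x ∂μ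
      ≤ K * ENNReal.ofReal (r ^ e * (1 - a ^ e)⁻¹) := by
  have hae0 : 0 ≤ a ^ e := by positivity
  have hterm (j : ℕ) : (r * a ^ j) ^ e = r ^ e * (a ^ e) ^ j := by
    rw [Real.mul_rpow hr.le (by positivity), Real.rpow_pow_comm ha.le]
  have hsum : ∑' j : ℕ, ENNReal.ofReal (r ^ e * (a ^ e) ^ j)
      = ENNReal.ofReal (r ^ e * (1 - a ^ e)⁻¹) := by
    rw [← ENNReal.ofReal_tsum_of_nonneg (fun j => by positivity)
      ((summable_geometric_of_lt_one hae0 hae).mul_left _), tsum_mul_left,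
      tsum_geometric_of_lt_one hae0 hae]
  calc ∫⁻ x in D ⁻¹' ⋃ j : ℕ, Ico (r * a ^ j / 2) (r * a ^ j), Φ x ∂μ
      ≤ ∑' j : ℕ, ∫⁻ x in D ⁻¹' Ico (r * a ^ j / 2) (r * a ^ j), Φ x ∂μ := by
        rw [preimage_iUnion]
        exact lintegral_iUnion_le _ _
    _ ≤ ∑' j : ℕ, K * ENNReal.ofReal (r ^ e * (a ^ e) ^ j) :=
        ENNReal.tsum_le_tsum fun j => hterm j ▸ H j
    _ = K * ENNReal.ofReal (r ^ e * (1 - a ^ e)⁻¹) := by rw [ENNReal.tsum_mul_left, hsum]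

theorem setLIntegral_preimage_Ioo_le_of_shell (hr : 0 < r) (he : 0 < e)
    (H : ∀ ρ, 0 < ρ → ρ ≤ r →
      ∫⁻ x in D ⁻¹' Ico (ρ / 2) ρ, Φ x ∂μ ≤ K * ENNReal.ofReal (ρ ^ e)) :
    ∫⁻ x in D ⁻¹' Ioo 0 r, Φ x ∂μ ≤ K * ENNReal.ofReal (r ^ e * (1 - (1 / 2) ^ e)⁻¹) :=
  (lintegral_mono_set (preimage_mono (Ioo_zero_subset_iUnion_Ico hr))).trans <|
    setLIntegral_preimage_iUnion_shell_le hr (by norm_num)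
      (Real.rpow_lt_one (by norm_num) (by norm_num) he) fun _ => H _ (by positivity)
        (mul_le_of_le_one_right hr.le (pow_le_one₀ (by norm_num) (by norm_num)))

theorem setLIntegral_preimage_Ici_le_of_shell (hr : 0 < r) (he : e < 0)
    (H : ∀ ρ, 2 * r ≤ ρ → ∫⁻ x in D ⁻¹' Ico (ρ / 2) ρ, Φ x ∂μ ≤ K * ENNReal.ofReal (ρ ^ e)) :
    ∫⁻ x in D ⁻¹' Ici r, Φ x ∂μ ≤ K * ENNReal.ofReal (r ^ e * (1 - 2 ^ e)⁻¹) := by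
  have h2 : (2 : ℝ) ^ e < 1 := Real.rpow_lt_one_of_one_lt_of_neg one_lt_two he
  calc ∫⁻ x in D ⁻¹' Ici r, Φ x ∂μ
      ≤ ∫⁻ x in D ⁻¹' ⋃ j : ℕ, Ico (2 * r * 2 ^ j / 2) (2 * r * 2 ^ j), Φ x ∂μ :=
        lintegral_mono_set (preimage_mono (Ici_subset_iUnion_Ico hr))
    _ ≤ K * ENNReal.ofReal ((2 * r) ^ e * (1 - 2 ^ e)⁻¹) :=
        setLIntegral_preimage_iUnion_shell_le (by positivity) two_pos h2 fun _ => H _ <|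
          le_mul_of_one_le_right (by positivity) (one_le_pow₀ one_le_two)
    _ ≤ K * ENNReal.ofReal (r ^ e * (1 - 2 ^ e)⁻¹) := by
        have h2' : 0 ≤ (1 - (2 : ℝ) ^ e)⁻¹ := inv_nonneg.2 (sub_nonneg.2 h2.le)
        have hre : (2 * r) ^ e ≤ r ^ e :=
          Real.rpow_le_rpow_of_nonpos hr (by linarith) he.le
        exact mul_le_mul_right (ENNReal.ofReal_le_ofReal (mul_le_mul_of_nonneg_right hre h2')) _

theorem setLIntegral_preimage_Ico_le_of_shell (hr : 0 < r) (M : ℕ)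
    (H : ∀ ρ, 2 * r ≤ ρ → ∫⁻ x in D ⁻¹' Ico (ρ / 2) ρ, Φ x ∂μ ≤ K) :
    ∫⁻ x in D ⁻¹' Ico r (r * 2 ^ M), Φ x ∂μ ≤ M * K :=
  calc ∫⁻ x in D ⁻¹' Ico r (r * 2 ^ M), Φ x ∂μ
      ≤ ∑' j : Fin M, ∫⁻ x in D ⁻¹' Ico (2 * r * 2 ^ (j : ℕ) / 2) (2 * r * 2 ^ (j : ℕ)),
          Φ x ∂μ := by
        refine (lintegral_mono_set
          (preimage_mono (Ico_mul_two_pow_subset_iUnion_Ico hr M))).trans ?_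
        rw [preimage_iUnion]
        exact lintegral_iUnion_le _ _
    _ ≤ ∑' _ : Fin M, K := ENNReal.tsum_le_tsum fun j => H _ <|
        le_mul_of_one_le_right (by positivity) (one_le_pow₀ one_le_two)
    _ = M * K := by simp

end DyadicShells

section PoleWeight

open Metric

/-- The weight `1 + r / ‖y‖`, which is of order one at distance `r` from the pole `0` of `1 / ‖y‖`.
It is `ENNReal`-valued so as to be infinite, rather than the junk value `1`, at the pole. -/
def poleWeight {E : Type*} [NormedAddCommGroup E] (r : ℝ) (y : E) : ENNReal :=
  1 + ENNReal.ofReal r / ‖y‖ₑ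

variable {E F : Type*} [NormedAddCommGroup E] [NormedAddCommGroup F] {q r : ℝ}

theorem one_le_poleWeight (r : ℝ) (y : E) : 1 ≤ poleWeight r y := le_self_add

theorem ofReal_div_norm_le_poleWeight (r : ℝ) (y : E) :
    ENNReal.ofReal (r / ‖y‖) ≤ poleWeight r y := by
  refine le_add_left ?_
  rw [← ofReal_norm]
  exact ENNReal.ofReal_div_le (norm_nonneg y)

theorem ofReal_one_add_div_norm (hr : 0 ≤ r) {y : E} (hy : y ≠ 0) :
    ENNReal.ofReal (1 + r / ‖y‖) = poleWeight r y := by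
  rw [poleWeight, ENNReal.ofReal_add one_pos.le (by positivity), ENNReal.ofReal_one,
    ENNReal.ofReal_div_of_pos (norm_pos_iff.2 hy), ofReal_norm]

theorem poleWeight_le_two {y : E} (h : r ≤ ‖y‖) : poleWeight r y ≤ 2 :=
  calc poleWeight r y ≤ 1 + 1 := by
        rw [poleWeight, ← ofReal_norm]
        gcongr
        exact ENNReal.div_le_of_le_mul (by simpa using ENNReal.ofReal_le_ofReal h)
    _ = 2 := one_add_one_eq_two

theorem poleWeight_anti {y : E} {y' : F} (h : ‖y‖ ≤ ‖y'‖) : poleWeight r y' ≤ poleWeight r y := by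
  have h' : ‖y‖ₑ ≤ ‖y'‖ₑ := enorm_le_iff_norm_le.2 h
  unfold poleWeight
  gcongr

theorem poleWeight_smul [NormedSpace ℝ E] (hr : 0 < r) (y : E) :
    poleWeight r (r • y) = poleWeight 1 y := by
  rw [poleWeight, poleWeight, enorm_smul, Real.enorm_of_nonneg hr.le, ENNReal.ofReal_one, one_div]
  nth_rw 1 [← mul_one (ENNReal.ofReal r)]
  rw [ENNReal.mul_div_mul_left _ _ (by simpa using hr) ENNReal.ofReal_ne_top, one_div]

variable [MeasurableSpace E] [BorelSpace E]

theorem measurable_poleWeight (r : ℝ) : Measurable (poleWeight r : E → ENNReal) := by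
  unfold poleWeight
  fun_prop

variable [NormedSpace ℝ E] [FiniteDimensional ℝ E] (μ : Measure E) [μ.IsAddHaarMeasure]

theorem setLIntegral_ball_zero_one_poleWeight_lt_top (hq0 : 0 ≤ q)
    (hq : q < Module.finrank ℝ E) : ∫⁻ y in ball 0 1, poleWeight 1 y ^ q ∂μ < ⊤ := by
  have hd : 1 ≤ Module.finrank ℝ E := by exact_mod_cast hq0.trans_lt hq
  have : Nontrivial E := Module.nontrivial_of_finrank_pos hd
  have hint : IntegrableOn (fun y : E => 2 ^ q * ‖y‖ ^ (-q)) (ball 0 1) μ :=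
    integrableOn_ball_of_norm_le_rpow hd hq (C := 2 ^ q)
      (.of_forall fun y => (Real.norm_of_nonneg (by positivity)).le)
      (Measurable.aestronglyMeasurable (by fun_prop))
  refine lt_of_le_of_lt (lintegral_mono_ae ?_) hint.lintegral_lt_top
  filter_upwards [ae_restrict_mem measurableSet_ball, ae_restrict_of_ae (μ.ae_ne 0)] with y hy hy0
  have hpos : 0 < ‖y‖ := norm_pos_iff.2 hy0
  rw [← ofReal_one_add_div_norm one_pos.le hy0, ENNReal.ofReal_rpow_of_nonneg (by positivity) hq0,
    Real.rpow_neg hpos.le, ← Real.inv_rpow hpos.le, ← Real.mul_rpow two_pos.le (by positivity)]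
  gcongr
  have : 1 ≤ ‖y‖⁻¹ := (one_le_inv₀ hpos).2 (mem_ball_zero_iff.1 hy).le
  rw [one_div]
  linarith

theorem exists_setLIntegral_ball_one_poleWeight_le (hq0 : 0 ≤ q) (hq : q < Module.finrank ℝ E) :
    ∃ K : NNReal, ∀ z, ∫⁻ y in ball z 1, poleWeight 1 y ^ q ∂μ ≤ K := by
  have hnear := setLIntegral_ball_zero_one_poleWeight_lt_top μ hq0 hq
  have hfar : 2 ^ q * μ (ball 0 1) < ⊤ :=
    ENNReal.mul_lt_top (ENNReal.rpow_lt_top_of_nonneg hq0 (by simp)) measure_ball_lt_top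
  refine ⟨(∫⁻ y in ball 0 1, poleWeight 1 y ^ q ∂μ + 2 ^ q * μ (ball 0 1)).toNNReal, fun z => ?_⟩
  rw [ENNReal.coe_toNNReal (ENNReal.add_lt_top.2 ⟨hnear, hfar⟩).ne]
  calc ∫⁻ y in ball z 1, poleWeight 1 y ^ q ∂μ
      ≤ ∫⁻ y in ball 0 1 ∪ ball z 1 \ ball 0 1, poleWeight 1 y ^ q ∂μ :=
        lintegral_mono_set (by rw [Set.union_sdiff_self]; exact Set.subset_union_right)
    _ ≤ ∫⁻ y in ball 0 1, poleWeight 1 y ^ q ∂μ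
        + ∫⁻ y in ball z 1 \ ball 0 1, poleWeight 1 y ^ q ∂μ := lintegral_union_le _ _ _
    _ ≤ ∫⁻ y in ball 0 1, poleWeight 1 y ^ q ∂μ
        + ∫⁻ _ in ball z 1 \ ball 0 1, 2 ^ q ∂μ := by
        refine add_le_add le_rfl
          (setLIntegral_mono' (measurableSet_ball.diff measurableSet_ball) fun y hy => ?_)
        gcongr
        exact poleWeight_le_two (by simpa using hy.2)
    _ ≤ ∫⁻ y in ball 0 1, poleWeight 1 y ^ q ∂μ + 2 ^ q * μ (ball 0 1) := by
        rw [setLIntegral_const, ← Measure.addHaar_ball_center μ z]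
        gcongr
        exact Set.sdiff_subset

theorem exists_setLIntegral_ball_poleWeight_le (hq0 : 0 ≤ q) (hq : q < Module.finrank ℝ E) :
    ∃ K : NNReal, ∀ (z : E) (r : ℝ), 0 < r →
      ∫⁻ y in ball z r, poleWeight r y ^ q ∂μ
        ≤ K * ENNReal.ofReal (r ^ Module.finrank ℝ E) := by
  obtain ⟨K, hK⟩ := exists_setLIntegral_ball_one_poleWeight_le μ hq0 hq
  refine ⟨K, fun z r hr => ?_⟩
  have hd : 0 < r ^ Module.finrank ℝ E := by positivity
  have hμ : μ = ENNReal.ofReal (r ^ Module.finrank ℝ E) • μ.map (r • ·) := by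
    rw [Measure.map_addHaar_smul μ hr.ne', smul_smul, abs_of_pos (by positivity),
      ← ENNReal.ofReal_mul hd.le, mul_inv_cancel₀ hd.ne', ENNReal.ofReal_one, one_smul]
  have hball : (r • ·) ⁻¹' ball z r ⊆ ball (r⁻¹ • z) 1 := fun y hy => by
    have hy' : ‖r • (y - r⁻¹ • z)‖ < r * 1 := by
      simpa [smul_sub, smul_inv_smul₀ hr.ne', ← dist_eq_norm] using hy
    rw [norm_smul, Real.norm_of_nonneg hr.le, mul_lt_mul_iff_right₀ hr] at hy'
    rwa [mem_ball, dist_eq_norm]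
  calc ∫⁻ y in ball z r, poleWeight r y ^ q ∂μ
      = ENNReal.ofReal (r ^ Module.finrank ℝ E)
          * ∫⁻ y in (r • ·) ⁻¹' ball z r, poleWeight r (r • y) ^ q ∂μ := by
        conv_lhs => rw [hμ]
        rw [setLIntegral_smul_measure, setLIntegral_map measurableSet_ball
          ((measurable_poleWeight r).pow_const q) (by fun_prop), smul_eq_mul]
    _ ≤ ENNReal.ofReal (r ^ Module.finrank ℝ E)
          * ∫⁻ y in ball (r⁻¹ • z) 1, poleWeight 1 y ^ q ∂μ := by
        simp only [poleWeight_smul hr]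
        gcongr
    _ ≤ K * ENNReal.ofReal (r ^ Module.finrank ℝ E) := by
        rw [mul_comm]
        gcongr
        exact hK _

end PoleWeight

section HausdorffMeasure

variable {Y : Type*} [MetricSpace Y] [MeasurableSpace Y] [BorelSpace Y]

theorem map_restrict_hausdorffMeasure_le {E : Type*} [MetricSpace E] [MeasurableSpace E]
    [BorelSpace E] {d : ℝ} (hd : 0 ≤ d) {L : NNReal} {A : Set Y} {P : Y → E} (hP : Measurable P)
    (hL : AntilipschitzWith L (A.domRestrict P)) :
    (μH[d].restrict A).map P ≤ (L : ENNReal) ^ d • μH[d] := by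
  refine Measure.le_iff.2 fun T hT => ?_
  have himage : A.domRestrict P '' (Subtype.val ⁻¹' (P ⁻¹' T)) ⊆ T := by
    rintro _ ⟨y, hy, rfl⟩
    exact hy
  calc (μH[d].restrict A).map P T = μH[d] (A ∩ P ⁻¹' T) := by
        rw [Measure.map_apply hP hT, Measure.restrict_apply (hP hT), Set.inter_comm]
    _ = μH[d] (Subtype.val ⁻¹' (P ⁻¹' T) : Set A) := by
        rw [← Subtype.image_preimage_coe, isometry_subtype_coe.hausdorffMeasure_image (Or.inl hd)]
    _ ≤ (L : ENNReal) ^ d * μH[d] (A.domRestrict P '' (Subtype.val ⁻¹' (P ⁻¹' T))) :=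
        hL.le_hausdorffMeasure_image hd _
    _ ≤ ((L : ENNReal) ^ d • μH[d]) T := by
        rw [Measure.smul_apply, smul_eq_mul]
        gcongr

variable {E : Type*} [NormedAddCommGroup E] [NormedSpace ℝ E] [FiniteDimensional ℝ E]
  [MeasurableSpace E] [BorelSpace E]

variable (Y) in
theorem exists_map_restrict_euclideanHausdorffMeasure_le (μ : Measure E) [μ.IsAddHaarMeasure]
    {d : ℕ} (hd : Module.finrank ℝ E = d) (L : NNReal) :
    ∃ K : NNReal, ∀ (A : Set Y) (P : Y → E), Measurable P → AntilipschitzWith L (A.domRestrict P) →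
      ((μHE[d] : Measure Y).restrict A).map P ≤ (K : ENNReal) • μ := by
  subst hd
  obtain ⟨s, hs⟩ : ∃ s : NNReal, (μH[(Module.finrank ℝ E : ℕ)] : Measure E) = s • μ :=
    ⟨_, Measure.isAddLeftInvariant_eq_smul _ _⟩
  obtain ⟨t, ht⟩ : ∃ t : NNReal, (μHE[Module.finrank ℝ E] : Measure Y)
      = t • μH[(Module.finrank ℝ E : ℕ)] := ⟨_, Measure.euclideanHausdorffMeasure_def _⟩
  refine ⟨t * (L ^ Module.finrank ℝ E * s), fun A P hP hL => ?_⟩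
  calc ((μHE[Module.finrank ℝ E] : Measure Y).restrict A).map P
      = (t : ENNReal) • (μH[(Module.finrank ℝ E : ℕ)].restrict A).map P := by
        rw [ht, Measure.restrict_smul, Measure.map_smul, ENNReal.smul_def]
    _ ≤ (t : ENNReal) • (L : ENNReal) ^ (Module.finrank ℝ E : ℝ) • (s : ENNReal) • μ := by
        rw [← ENNReal.smul_def s, ← hs]
        gcongr
        exact map_restrict_hausdorffMeasure_le (Nat.cast_nonneg _) hP hL
    _ = ((t * (L ^ Module.finrank ℝ E * s) : NNReal) : ENNReal) • μ := by
        rw [smul_smul, smul_smul, ENNReal.rpow_natCast, mul_assoc]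
        push_cast
        rfl

end HausdorffMeasure

section Sectors

/-- The four sectors `|y| ≤ 2 Re (iʲ y)` of the complex plane, of half-angle `π / 3`: together they
cover the plane, and within one of them there is no cancellation in sums. -/
def sector (j : Fin 4) : Set ℂ := {y | ‖y‖ ≤ 2 * (Complex.I ^ (j : ℕ) * y).re}

theorem exists_mem_sector (y : ℂ) : ∃ j, y ∈ sector j := by
  have h := Complex.norm_le_abs_re_add_abs_im y
  rcases le_total |y.im| |y.re| with h' | h'
  · rcases abs_cases y.re with hy | hy
    · exact ⟨0, show ‖y‖ ≤ 2 * (Complex.I ^ 0 * y).re by rw [pow_zero, one_mul]; linarith⟩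
    · exact ⟨2, show ‖y‖ ≤ 2 * (Complex.I ^ 2 * y).re by
        rw [Complex.I_sq, neg_one_mul, Complex.neg_re]; linarith⟩
  · rcases abs_cases y.im with hy | hy
    · exact ⟨3, show ‖y‖ ≤ 2 * (Complex.I ^ 3 * y).re by
        rw [Complex.I_pow_three, neg_mul, Complex.neg_re, Complex.I_mul_re]; linarith⟩
    · exact ⟨1, show ‖y‖ ≤ 2 * (Complex.I ^ 1 * y).re by
        rw [pow_one, Complex.I_mul_re]; linarith⟩

theorem norm_add_norm_le_of_mem_sector {j : Fin 4} {x y : ℂ} (hx : x ∈ sector j)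
    (hy : y ∈ sector j) : ‖x‖ + ‖y‖ ≤ 2 * ‖x + y‖ :=
  calc ‖x‖ + ‖y‖ ≤ 2 * (Complex.I ^ (j : ℕ) * x).re + 2 * (Complex.I ^ (j : ℕ) * y).re :=
        add_le_add hx hy
    _ = 2 * (Complex.I ^ (j : ℕ) * (x + y)).re := by rw [mul_add, Complex.add_re]; ring
    _ ≤ 2 * ‖Complex.I ^ (j : ℕ) * (x + y)‖ := by gcongr; exact Complex.re_le_norm _
    _ = 2 * ‖x + y‖ := by simp

end Sectors

section IsotropicCone

theorem norm_le_card_mul {ι : Type*} [Fintype ι] {a : EuclideanSpace ℂ ι} {d : ℝ}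
    (h : ∀ i, ‖a i‖ ≤ d) : ‖a‖ ≤ Fintype.card ι * d := by
  have hsum : ‖a‖ ≤ ∑ i, ‖a i‖ := by
    refine le_of_sq_le_sq ?_ (by positivity)
    rw [EuclideanSpace.norm_sq_eq]
    exact Finset.sum_sq_le_sq_sum_of_nonneg fun i _ => norm_nonneg _
  refine hsum.trans ((Finset.sum_le_card_nsmul _ _ d fun i _ => h i).trans_eq ?_)
  rw [nsmul_eq_mul, Finset.card_univ]

variable {k : ℕ} {p : Fin k} {j : Fin 4} {z z' : EuclideanSpace ℂ (Fin k)}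

/-- The part of the cone `z • z = 0`, `z ≠ 0` on which the `p`-th coordinate is dominant and lies in
a fixed sector. There the remaining coordinates serve as a chart. -/
def conePiece (p : Fin k) (j : Fin 4) : Set (EuclideanSpace ℂ (Fin k)) :=
  {z | z ≠ 0 ∧ bdot z z = 0 ∧ (∀ i, ‖z i‖ ≤ ‖z p‖) ∧ z p ∈ sector j}

theorem exists_mem_conePiece (h0 : z ≠ 0) (hz : bdot z z = 0) :
    ∃ s : Fin k × Fin 4, z ∈ conePiece s.1 s.2 := by
  have : Nonempty (Fin k) := by
    by_contra h
    rw [not_nonempty_iff] at h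
    exact h0 (Subsingleton.elim _ _)
  obtain ⟨p, hp⟩ := Finite.exists_max fun i => ‖z i‖
  obtain ⟨j, hj⟩ := exists_mem_sector (z p)
  exact ⟨(p, j), h0, hz, hp, hj⟩

theorem norm_le_of_mem_conePiece (hz : z ∈ conePiece p j) : ‖z‖ ≤ k * ‖z p‖ := by
  simpa using norm_le_card_mul hz.2.2.1

theorem norm_apply_pos_of_mem_conePiece (hz : z ∈ conePiece p j) : 0 < ‖z p‖ :=
  pos_of_mul_pos_right ((norm_pos_iff.2 hz.1).trans_le (norm_le_of_mem_conePiece hz))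
    k.cast_nonneg

theorem sub_mul_add_eq_neg_sum (hz : bdot z z = 0) (hz' : bdot z' z' = 0) (p : Fin k) :
    (z p - z' p) * (z p + z' p)
      = -∑ i ∈ Finset.univ.erase p, (z i - z' i) * (z i + z' i) := by
  have hsum : ∑ i, (z i - z' i) * (z i + z' i) = bdot z z - bdot z' z' := by
    rw [bdot, bdot, ← Finset.sum_sub_distrib]
    exact Finset.sum_congr rfl fun i _ => by ring
  rw [hz, hz', sub_zero, ← Finset.add_sum_erase _ _ (Finset.mem_univ p)] at hsum
  exact eq_neg_of_add_eq_zero_left hsum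

theorem norm_sub_apply_le_of_mem_conePiece (hz : z ∈ conePiece p j) (hz' : z' ∈ conePiece p j)
    {d : ℝ} (hd0 : 0 ≤ d) (hd : ∀ i, i ≠ p → ‖z i - z' i‖ ≤ d) (i : Fin k) :
    ‖z i - z' i‖ ≤ 2 * k * d := by
  have hk : (1 : ℝ) ≤ k := by exact_mod_cast Nat.one_le_of_lt p.2
  obtain hip | rfl := ne_or_eq i p
  · exact (hd i hip).trans (le_mul_of_one_le_left hd0 (by linarith))
  have hS : 0 < ‖z i‖ + ‖z' i‖ :=
    add_pos (norm_apply_pos_of_mem_conePiece hz) (norm_apply_pos_of_mem_conePiece hz')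
  have hterm : ∀ u ∈ Finset.univ.erase i,
      ‖(z u - z' u) * (z u + z' u)‖ ≤ d * (‖z i‖ + ‖z' i‖) := fun u hu => by
    rw [norm_mul]
    exact mul_le_mul (hd u (Finset.ne_of_mem_erase hu))
      ((norm_add_le _ _).trans (add_le_add (hz.2.2.1 u) (hz'.2.2.1 u))) (norm_nonneg _) hd0
  have hcard : ((Finset.univ.erase i).card : ℝ) ≤ k := by
    exact_mod_cast (Finset.card_le_univ _).trans_eq (Fintype.card_fin k)
  refine le_of_mul_le_mul_right ?_ hS
  calc ‖z i - z' i‖ * (‖z i‖ + ‖z' i‖) ≤ ‖z i - z' i‖ * (2 * ‖z i + z' i‖) := by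
        gcongr
        exact norm_add_norm_le_of_mem_sector hz.2.2.2 hz'.2.2.2
    _ = 2 * ‖∑ u ∈ Finset.univ.erase i, (z u - z' u) * (z u + z' u)‖ := by
        rw [← norm_neg (∑ u ∈ _, _), ← sub_mul_add_eq_neg_sum hz.2.1 hz'.2.1, norm_mul]
        ring
    _ ≤ 2 * ((Finset.univ.erase i).card * (d * (‖z i‖ + ‖z' i‖))) := by
        rw [← nsmul_eq_mul (Finset.card _)]
        gcongr
        exact (norm_sum_le _ _).trans (Finset.sum_le_card_nsmul _ _ _ hterm)
    _ ≤ 2 * (k * (d * (‖z i‖ + ‖z' i‖))) := by gcongr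
    _ = 2 * k * d * (‖z i‖ + ‖z' i‖) := by ring

/-- The square of the dominant coordinate is minus the sum of the other squares. -/
theorem exists_ne_norm_apply_le_of_mem_conePiece (hz : z ∈ conePiece p j) :
    ∃ v, v ≠ p ∧ ‖z p‖ ≤ k * ‖z v‖ := by
  by_contra! h
  have hp := norm_apply_pos_of_mem_conePiece hz
  have hsq : z p * z p = -∑ i ∈ Finset.univ.erase p, z i * z i := by
    simpa using sub_mul_add_eq_neg_sum hz.2.1 (z' := 0) (by simp [bdot]) p
  have hcard : ((Finset.univ.erase p).card : ℝ) < k := by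
    rw [Finset.card_erase_of_mem (Finset.mem_univ p), Finset.card_univ, Fintype.card_fin]
    exact_mod_cast Nat.sub_one_lt_of_lt p.2
  have hterm : ∀ i ∈ Finset.univ.erase p, k * ‖z i * z i‖ ≤ ‖z p‖ ^ 2 := fun i hi => by
    rw [norm_mul, ← mul_assoc, sq]
    exact mul_le_mul (h i (Finset.ne_of_mem_erase hi)).le (hz.2.2.1 i) (norm_nonneg _) hp.le
  have hle : k * ‖z p‖ ^ 2 ≤ (Finset.univ.erase p).card * ‖z p‖ ^ 2 :=
    calc k * ‖z p‖ ^ 2 = k * ‖∑ i ∈ Finset.univ.erase p, z i * z i‖ := by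
          rw [← norm_neg (∑ i ∈ _, _), ← hsq, norm_mul, sq]
      _ ≤ ∑ i ∈ Finset.univ.erase p, k * ‖z i * z i‖ := by
          rw [← Finset.mul_sum]
          gcongr
          exact norm_sum_le _ _
      _ ≤ (Finset.univ.erase p).card * ‖z p‖ ^ 2 := by
          rw [← nsmul_eq_mul]
          exact Finset.sum_le_card_nsmul _ _ _ hterm
  exact hcard.not_ge (le_of_mul_le_mul_right hle (by positivity))

end IsotropicCone

section ConeWeight

theorem ofReal_div_norm_rpow_le {E : Type*} [NormedAddCommGroup E] {a r s q : ℝ} (hr : 0 < r)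
    (ha0 : 0 ≤ a) (ha1 : a ≤ 1) (hs : 0 ≤ s) (hsq : s ≤ q) (y : E) :
    ENNReal.ofReal ((a / ‖y‖) ^ s) ≤ ENNReal.ofReal (r ^ (-s)) * poleWeight r y ^ q :=
  calc ENNReal.ofReal ((a / ‖y‖) ^ s) ≤ ENNReal.ofReal ((r⁻¹ * (r / ‖y‖)) ^ s) := by
        gcongr
        rw [← mul_div_assoc, inv_mul_cancel₀ hr.ne']
        gcongr
    _ = ENNReal.ofReal (r ^ (-s)) * ENNReal.ofReal (r / ‖y‖) ^ s := by
        rw [Real.mul_rpow (by positivity) (by positivity), Real.inv_rpow hr.le,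
          ← Real.rpow_neg hr.le, ENNReal.ofReal_mul (by positivity),
          ENNReal.ofReal_rpow_of_nonneg (by positivity) hs]
    _ ≤ ENNReal.ofReal (r ^ (-s)) * poleWeight r y ^ q :=
        mul_le_mul_right ((ENNReal.rpow_le_rpow (ofReal_div_norm_le_poleWeight r y) hs).trans
          (ENNReal.rpow_le_rpow_of_exponent_le (one_le_poleWeight r y) hsq)) _

theorem one_le_sixteen_mul_rpow_neg {r s : ℝ} (hr : 0 < r) (hr4 : r ≤ 4) (hs0 : 0 ≤ s)
    (hs2 : s ≤ 2) : 1 ≤ 16 * r ^ (-s) := by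
  rw [Real.rpow_neg hr.le, ← div_eq_mul_inv, one_le_div (by positivity)]
  calc r ^ s ≤ 4 ^ s := by gcongr
    _ ≤ 4 ^ (2 : ℝ) := by gcongr; norm_num
    _ = 16 := by norm_num

theorem div_rpow_le_pow_four {a b k s : ℝ} (ha : 0 ≤ a) (hb : 0 ≤ b) (hk : 1 ≤ k)
    (hab : a ≤ k ^ 2 * b) (hs0 : 0 ≤ s) (hs2 : s ≤ 2) : (a / b) ^ s ≤ k ^ 4 :=
  calc (a / b) ^ s ≤ (k ^ 2) ^ s := by
        gcongr
        exact div_le_of_le_mul₀ hb (by positivity) hab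
    _ ≤ (k ^ 2) ^ (2 : ℝ) := by
        gcongr
        exact one_le_pow₀ hk
    _ = k ^ 4 := by norm_cast; ring

variable {k : ℕ} {p : Fin k} {j : Fin 4} {z : EuclideanSpace ℂ (Fin k)} {q r : ℝ}

theorem poleWeight_rpow_le_prod (hq : 0 < q) (r : ℝ) (z : EuclideanSpace ℂ (Fin k)) {v : Fin k}
    (hv : v ≠ p) :
    poleWeight r z ^ q ≤ ∏ i : {i // i ≠ p}, poleWeight r (z i) ^ q := by
  refine (ENNReal.rpow_le_rpow (poleWeight_anti (PiLp.norm_apply_le z v)) hq.le).trans ?_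
  exact Finset.single_le_prod' (f := fun i : {i // i ≠ p} => poleWeight r (z i) ^ q)
    (a := ⟨v, hv⟩) (fun _ _ => ENNReal.one_le_rpow (one_le_poleWeight r _) hq)
    (Finset.mem_univ _)

theorem poleWeight_rpow_mul_poleWeight_apply_rpow_le_prod (hq : 0 < q) (r : ℝ)
    (z : EuclideanSpace ℂ (Fin k)) {u v : Fin k} (hu : u ≠ p) (hv : v ≠ p) (huv : u ≠ v) :
    poleWeight r (z u) ^ q * poleWeight r z ^ q
      ≤ ∏ i : {i // i ≠ p}, poleWeight r (z i) ^ q := by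
  refine (mul_le_mul_right (ENNReal.rpow_le_rpow
    (poleWeight_anti (PiLp.norm_apply_le z v)) hq.le) _).trans ?_
  exact Finset.mul_le_prod (f := fun i : {i // i ≠ p} => poleWeight r (z i) ^ q)
    (i := ⟨u, hu⟩) (j := ⟨v, hv⟩)
    (fun _ _ => ENNReal.one_le_rpow (one_le_poleWeight r _) hq) (Finset.mem_univ _)
    (Finset.mem_univ _) (by simpa using huv)

/-- If `z u` is not comparable to `‖z‖`, then some coordinate other than `z u` and the dominant one
is: it takes the factor `poleWeight r z`, and `z u` takes the singularity of `‖z‖ / ‖z u‖`. -/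
theorem poleWeight_rpow_mul_ratio_rpow_le_prod (hz : z ∈ conePiece p j) (hz1 : ‖z‖ ≤ 1)
    (hq1 : 1 ≤ q) (hq2 : q ≤ 2) (hr : 0 < r) (hr4 : r ≤ 4) (u : Fin k) :
    poleWeight r z ^ q * ENNReal.ofReal ((‖z‖ / ‖z u‖) ^ (2 * (q - 1)))
      ≤ ENNReal.ofReal (16 * k ^ 4 * r ^ (-(2 * (q - 1))))
        * ∏ i : {i // i ≠ p}, poleWeight r (z i) ^ q := by
  obtain ⟨v, hvp, hv⟩ := exists_ne_norm_apply_le_of_mem_conePiece hz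
  have hq0 : 0 < q := by linarith
  have hk : (1 : ℝ) ≤ k := by exact_mod_cast Nat.one_le_of_lt p.2
  have hr16 := one_le_sixteen_mul_rpow_neg hr hr4 (s := 2 * (q - 1)) (by linarith) (by linarith)
  rcases le_or_gt ‖z‖ (k ^ 2 * ‖z u‖) with hu | hu
  · have hratio := (div_rpow_le_pow_four (s := 2 * (q - 1)) (norm_nonneg z) (norm_nonneg _) hk hu
      (by linarith) (by linarith)).trans (le_mul_of_one_le_left (by positivity) hr16)
    rw [mul_right_comm, mul_comm]
    gcongr
    exact poleWeight_rpow_le_prod hq0 r z hvp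
  · have hzp : ‖z‖ ≤ k * ‖z p‖ := norm_le_of_mem_conePiece hz
    have hup : u ≠ p := by
      rintro rfl
      have : k * ‖z u‖ ≤ k ^ 2 * ‖z u‖ := by gcongr; exact le_self_pow₀ hk two_ne_zero
      linarith
    have huv : u ≠ v := by
      rintro rfl
      have : k * ‖z p‖ ≤ k * (k * ‖z u‖) := by gcongr
      linarith
    calc poleWeight r z ^ q * ENNReal.ofReal ((‖z‖ / ‖z u‖) ^ (2 * (q - 1)))
        ≤ poleWeight r z ^ q
            * (ENNReal.ofReal (r ^ (-(2 * (q - 1)))) * poleWeight r (z u) ^ q) := by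
          gcongr
          exact ofReal_div_norm_rpow_le hr (norm_nonneg z) hz1 (by linarith) (by linarith) (z u)
      _ = ENNReal.ofReal (r ^ (-(2 * (q - 1))))
            * (poleWeight r (z u) ^ q * poleWeight r z ^ q) := by
          ring
      _ ≤ _ := by
          gcongr ENNReal.ofReal ?_ * ?_
          · exact le_mul_of_one_le_left (by positivity)
              (by nlinarith [one_le_pow₀ hk (n := 4)])
          · exact poleWeight_rpow_mul_poleWeight_apply_rpow_le_prod hq0 r z hup hvp huv

end ConeWeight

section Components

variable {l n m : ℕ}

theorem norm_sq_eq_add (Z : Amb l n m) :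
    ‖Z‖ ^ 2 = ‖xPart Z‖ ^ 2 + (‖zPart Z‖ ^ 2 + ‖wPart Z‖ ^ 2) := by
  simp only [EuclideanSpace.norm_sq_eq, Fintype.sum_sum_type]
  rfl

theorem norm_zPart_le (Z : Amb l n m) : ‖zPart Z‖ ≤ ‖Z‖ :=
  le_of_sq_le_sq (by rw [norm_sq_eq_add Z]; linarith [sq_nonneg ‖xPart Z‖, sq_nonneg ‖wPart Z‖])
    (norm_nonneg Z)

theorem norm_wPart_le (Z : Amb l n m) : ‖wPart Z‖ ≤ ‖Z‖ :=
  le_of_sq_le_sq (by rw [norm_sq_eq_add Z]; linarith [sq_nonneg ‖xPart Z‖, sq_nonneg ‖zPart Z‖])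
    (norm_nonneg Z)

@[fun_prop]
theorem continuous_zPart : Continuous (zPart : Amb l n m → _) := by
  unfold zPart
  fun_prop

@[fun_prop]
theorem continuous_wPart : Continuous (wPart : Amb l n m → _) := by
  unfold wPart
  fun_prop

@[fun_prop]
theorem measurable_zPart : Measurable (zPart : Amb l n m → _) := continuous_zPart.measurable

@[fun_prop]
theorem measurable_wPart : Measurable (wPart : Amb l n m → _) := continuous_wPart.measurable

@[fun_prop]
theorem measurable_wt : Measurable (wt : Amb l n m → ℝ) := by
  unfold wt
  fun_prop

theorem measurableSet_MN : MeasurableSet (MN l n m) := by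
  have hbdot (k : ℕ) : Continuous fun z : EuclideanSpace ℂ (Fin k) => bdot z z := by
    unfold bdot
    fun_prop
  refine MeasurableSet.inter ?_ measurableSet_ball
  exact (isOpen_ne.preimage continuous_zPart).measurableSet.inter
    ((isOpen_ne.preimage continuous_wPart).measurableSet.inter
      ((isClosed_singleton.preimage ((hbdot _).comp continuous_zPart)).measurableSet.inter
        (isClosed_singleton.preimage ((hbdot _).comp continuous_wPart)).measurableSet))

end Components

section Chart

variable {l n m : ℕ} {p : Fin (n + 1)} {p' : Fin (m + 1)} {j j' : Fin 4} {q r : ℝ}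

/-- The coordinates of `ℂˡ × ℂⁿ⁺¹ × ℂᵐ⁺¹` other than one `z`- and one `w`-coordinate. -/
abbrev ChartIdx (l : ℕ) {n m : ℕ} (p : Fin (n + 1)) (p' : Fin (m + 1)) : Type :=
  Fin l ⊕ ({i // i ≠ p} ⊕ {i // i ≠ p'})

/-- The chart of `ℍ_N` that forgets one `z`- and one `w`-coordinate. -/
def chart (p : Fin (n + 1)) (p' : Fin (m + 1)) (Z : Amb l n m) : ChartIdx l p p' → ℂ :=
  fun i => Z (Sum.map id (Sum.map Subtype.val Subtype.val) i)

theorem measurable_chart : Measurable (chart p p' : Amb l n m → _) := by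
  unfold chart
  fun_prop

theorem dist_chart_le (Z Z' : Amb l n m) : dist (chart p p' Z) (chart p p' Z') ≤ dist Z Z' :=
  (dist_pi_le_iff dist_nonneg).2 fun _ => PiLp.dist_apply_le Z Z' _

theorem card_chartIdx (p : Fin (n + 1)) (p' : Fin (m + 1)) :
    Fintype.card (ChartIdx l p p') = l + n + m := by
  simp [Fintype.card_subtype_compl, add_assoc]

variable (l) in
/-- The part of `ℍ_N` on which `z_p` and `w_p'` are dominant coordinates, each in a fixed sector. -/
def HNPiece (p : Fin (n + 1)) (p' : Fin (m + 1)) (j j' : Fin 4) : Set (Amb l n m) :=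
  {Z | zPart Z ∈ conePiece p j ∧ wPart Z ∈ conePiece p' j'}

theorem exists_antilipschitzWith_chart (p : Fin (n + 1)) (p' : Fin (m + 1)) (j j' : Fin 4) :
    ∃ L, AntilipschitzWith L ((HNPiece l p p' j j').domRestrict (chart p p')) := by
  let C : ℝ := 2 * (l + n + m + 1)
  have hC : ∀ a : ℝ, a ≤ C → ∀ d : ℝ, 0 ≤ d → a * d ≤ C * d := fun a ha d hd => by gcongr
  refine ⟨(Fintype.card (Idx l n m) * C).toNNReal, AntilipschitzWith.of_le_mul_dist ?_⟩
  rintro ⟨Z, hz, hw⟩ ⟨Z', hz', hw'⟩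
  let d := dist (chart p p' Z) (chart p p' Z')
  have hd0 : 0 ≤ d := dist_nonneg
  have hd (i : ChartIdx l p p') : ‖chart p p' Z i - chart p p' Z' i‖ ≤ d :=
    (dist_eq_norm _ _).symm.trans_le (dist_le_pi_dist _ _ i)
  have hall (i : Idx l n m) : ‖(Z - Z') i‖ ≤ C * d := by
    obtain i | i | i := i
    · exact (hd (Sum.inl i)).trans (le_mul_of_one_le_left hd0 (by simp only [C]; norm_cast; omega))
    · exact (norm_sub_apply_le_of_mem_conePiece hz hz' hd0
        (fun u hu => hd (Sum.inr (Sum.inl ⟨u, hu⟩))) i).trans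
          (hC _ (by simp only [C]; norm_cast; omega) d hd0)
    · exact (norm_sub_apply_le_of_mem_conePiece hw hw' hd0
        (fun u hu => hd (Sum.inr (Sum.inr ⟨u, hu⟩))) i).trans
          (hC _ (by simp only [C]; norm_cast; omega) d hd0)
  rw [Subtype.dist_eq, dist_eq_norm, Real.coe_toNNReal _ (by positivity), mul_assoc]
  exact norm_le_card_mul hall

theorem wt_rpow_mul_poleWeight_rpow_le_prod {Θ : Amb l n m} (hΘ : Θ ∈ HNPiece l p p' j j')
    (hΘ1 : ‖Θ‖ ≤ 1) (hq1 : 1 ≤ q) (hq2 : q ≤ 2) (hr : 0 < r) (hr4 : r ≤ 4) :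
    ENNReal.ofReal (wt Θ ^ (2 * (q - 1))) * (poleWeight r (zPart Θ) * poleWeight r (wPart Θ)) ^ q
      ≤ ENNReal.ofReal (16 * (n + 1 : ℕ) ^ 4 * r ^ (-(2 * (q - 1)))
            * (16 * (m + 1 : ℕ) ^ 4 * r ^ (-(2 * (q - 1)))))
          * ∏ i, poleWeight r (chart p p' Θ i) ^ q := by
  have hx : 1 ≤ ∏ i : Fin l, poleWeight r (Θ (Sum.inl i)) ^ q :=
    Finset.one_le_prod' fun i _ => ENNReal.one_le_rpow (one_le_poleWeight _ _) (by linarith)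
  calc ENNReal.ofReal (wt Θ ^ (2 * (q - 1)))
        * (poleWeight r (zPart Θ) * poleWeight r (wPart Θ)) ^ q
      = (poleWeight r (zPart Θ) ^ q
          * ENNReal.ofReal ((‖zPart Θ‖ / ‖zPart Θ (Fin.last n)‖) ^ (2 * (q - 1))))
        * (poleWeight r (wPart Θ) ^ q
          * ENNReal.ofReal ((‖wPart Θ‖ / ‖wPart Θ (Fin.last m)‖) ^ (2 * (q - 1)))) := by
        rw [wt, mul_div_mul_comm, Real.mul_rpow (by positivity) (by positivity),
          ENNReal.ofReal_mul (by positivity), ENNReal.mul_rpow_of_nonneg _ _ (by linarith)]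
        ring
    _ ≤ (ENNReal.ofReal (16 * (n + 1 : ℕ) ^ 4 * r ^ (-(2 * (q - 1))))
          * ∏ i : {i // i ≠ p}, poleWeight r (zPart Θ i) ^ q)
        * (ENNReal.ofReal (16 * (m + 1 : ℕ) ^ 4 * r ^ (-(2 * (q - 1))))
          * ∏ i : {i // i ≠ p'}, poleWeight r (wPart Θ i) ^ q) :=
        mul_le_mul'
          (poleWeight_rpow_mul_ratio_rpow_le_prod hΘ.1 ((norm_zPart_le Θ).trans hΘ1) hq1 hq2 hr
            hr4 _)
          (poleWeight_rpow_mul_ratio_rpow_le_prod hΘ.2 ((norm_wPart_le Θ).trans hΘ1) hq1 hq2 hr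
            hr4 _)
    _ = ENNReal.ofReal (16 * (n + 1 : ℕ) ^ 4 * r ^ (-(2 * (q - 1)))
            * (16 * (m + 1 : ℕ) ^ 4 * r ^ (-(2 * (q - 1)))))
        * (1 * ((∏ i : {i // i ≠ p}, poleWeight r (zPart Θ i) ^ q)
          * ∏ i : {i // i ≠ p'}, poleWeight r (wPart Θ i) ^ q)) := by
        rw [one_mul, mul_mul_mul_comm, ← ENNReal.ofReal_mul (by positivity)]
    _ ≤ _ := by
        rw [Fintype.prod_sum_type, Fintype.prod_sum_type]
        exact mul_le_mul_right (mul_le_mul_left hx _) _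

end Chart

section VolumeGrowth

open Metric

theorem measurable_prod_poleWeight {ι E : Type*} [Fintype ι] [NormedAddCommGroup E]
    [MeasurableSpace E] [BorelSpace E] (r q : ℝ) :
    Measurable fun y : ι → E => ∏ i, poleWeight r (y i) ^ q :=
  Finset.measurable_prod _ fun i _ =>
    ((measurable_poleWeight r).pow_const q).comp (measurable_pi_apply i)

theorem exists_setLIntegral_pi_ball_poleWeight_le {ι E : Type*} [Fintype ι] [NormedAddCommGroup E]
    [NormedSpace ℝ E] [FiniteDimensional ℝ E] [MeasurableSpace E] [BorelSpace E] (μ : Measure E)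
    [μ.IsAddHaarMeasure] {q : ℝ} (hq0 : 0 ≤ q) (hq : q < Module.finrank ℝ E) :
    ∃ K : NNReal, ∀ (z : ι → E) (r : ℝ), 0 < r →
      ∫⁻ y in ball z r, ∏ i, poleWeight r (y i) ^ q ∂(Measure.pi fun _ => μ)
        ≤ K * ENNReal.ofReal (r ^ (Module.finrank ℝ E * Fintype.card ι)) := by
  obtain ⟨K, hK⟩ := exists_setLIntegral_ball_poleWeight_le μ hq0 hq
  refine ⟨K ^ Fintype.card ι, fun z r hr => ?_⟩
  calc ∫⁻ y in ball z r, ∏ i, poleWeight r (y i) ^ q ∂(Measure.pi fun _ => μ)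
      = ∏ i, ∫⁻ y in ball (z i) r, poleWeight r y ^ q ∂μ := by
        rw [ball_pi z hr, Measure.restrict_pi_pi]
        exact lintegral_pi_prod_eq_prod _ fun _ => (measurable_poleWeight r).pow_const q
    _ ≤ (K * ENNReal.ofReal (r ^ Module.finrank ℝ E)) ^ Fintype.card ι :=
        Finset.prod_le_pow_card _ _ _ fun i _ => hK (z i) r hr
    _ = _ := by
        rw [mul_pow, ← ENNReal.ofReal_pow (by positivity), ← pow_mul, ENNReal.coe_pow]

variable {l n m : ℕ} {q : ℝ}

theorem exists_setLIntegral_HNPiece_chart_le (p : Fin (n + 1)) (p' : Fin (m + 1)) (j j' : Fin 4)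
    (hq0 : 0 ≤ q) (hq2 : q < 2) :
    ∃ K : NNReal, ∀ (Z : Amb l n m) (r : ℝ), 0 < r →
      ∫⁻ Θ in HNPiece l p p' j j' ∩ ball Z r, ∏ i, poleWeight r (chart p p' Θ i) ^ q
          ∂μHE[2 * (l + n + m)]
        ≤ K * ENNReal.ofReal (r ^ (2 * (l + n + m))) := by
  obtain ⟨L, hL⟩ := exists_antilipschitzWith_chart (l := l) p p' j j'
  have hdim : Module.finrank ℝ (ChartIdx l p p' → ℂ) = 2 * (l + n + m) := by
    rw [Module.finrank_pi_fintype, Finset.sum_const, Finset.card_univ, card_chartIdx,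
      Complex.finrank_real_complex, smul_eq_mul, mul_comm]
  obtain ⟨K₁, hK₁⟩ := exists_map_restrict_euclideanHausdorffMeasure_le (Amb l n m)
    (volume : Measure (ChartIdx l p p' → ℂ)) hdim L
  obtain ⟨K₂, hK₂⟩ := exists_setLIntegral_pi_ball_poleWeight_le (ι := ChartIdx l p p')
    (volume : Measure ℂ) hq0 (by rw [Complex.finrank_real_complex]; exact_mod_cast hq2)
  rw [Complex.finrank_real_complex, card_chartIdx, ← volume_pi] at hK₂
  refine ⟨K₁ * K₂, fun Z r hr => ?_⟩
  calc ∫⁻ Θ in HNPiece l p p' j j' ∩ ball Z r, ∏ i, poleWeight r (chart p p' Θ i) ^ q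
          ∂μHE[2 * (l + n + m)]
      ≤ ∫⁻ Θ in chart p p' ⁻¹' ball (chart p p' Z) r, ∏ i, poleWeight r (chart p p' Θ i) ^ q
          ∂(μHE[2 * (l + n + m)]).restrict (HNPiece l p p' j j') := by
        rw [Measure.restrict_restrict (measurable_chart measurableSet_ball)]
        exact lintegral_mono_set fun Θ hΘ => ⟨(dist_chart_le Θ Z).trans_lt hΘ.2, hΘ.1⟩
    _ = ∫⁻ y in ball (chart p p' Z) r, ∏ i, poleWeight r (y i) ^ q
          ∂((μHE[2 * (l + n + m)]).restrict (HNPiece l p p' j j')).map (chart p p') :=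
        (setLIntegral_map measurableSet_ball (measurable_prod_poleWeight r q) measurable_chart).symm
    _ ≤ ∫⁻ y in ball (chart p p' Z) r, ∏ i, poleWeight r (y i) ^ q ∂((K₁ : ENNReal) • volume) :=
        lintegral_mono' (Measure.restrict_mono subset_rfl (hK₁ _ _ measurable_chart hL)) le_rfl
    _ ≤ _ := by
        rw [setLIntegral_smul_measure, smul_eq_mul, ENNReal.coe_mul, mul_assoc]
        gcongr
        exact hK₂ _ r hr

/-- The restriction of `dV` to `𝕄_N`, weighted by the second factor of the integrand. -/
def weightedVolume (l n m : ℕ) (q : ℝ) : Measure (Amb l n m) :=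
  ((dV l n m).restrict (MN l n m)).withDensity fun Θ => ENNReal.ofReal (wt Θ ^ (2 * (q - 1)))

theorem measurable_ofReal_wt_rpow (s : ℝ) :
    Measurable fun Θ : Amb l n m => ENNReal.ofReal (wt Θ ^ s) := by
  fun_prop

theorem lintegral_weightedVolume (q : ℝ) (f : Amb l n m → ENNReal) :
    ∫⁻ Θ, f Θ ∂weightedVolume l n m q
      = ∫⁻ Θ in MN l n m, ENNReal.ofReal (wt Θ ^ (2 * (q - 1))) * f Θ ∂dV l n m :=
  lintegral_withDensity_eq_lintegral_mul_non_measurable _ (measurable_ofReal_wt_rpow _)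
    (.of_forall fun _ => ENNReal.ofReal_lt_top) f

theorem ae_mem_MN_weightedVolume (q : ℝ) : ∀ᵐ Θ ∂weightedVolume l n m q, Θ ∈ MN l n m :=
  (withDensity_absolutelyContinuous _ _).ae_le (ae_restrict_mem measurableSet_MN)

theorem exists_setLIntegral_HNPiece_wt_le (p : Fin (n + 1)) (p' : Fin (m + 1)) (j j' : Fin 4)
    (hq1 : 1 ≤ q) (hq2 : q < 2) :
    ∃ K : NNReal, ∀ (Z : Amb l n m) (r : ℝ), 0 < r → r ≤ 4 →
      ∫⁻ Θ in HNPiece l p p' j j' ∩ (ball 0 1 ∩ ball Z r), ENNReal.ofReal (wt Θ ^ (2 * (q - 1)))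
          * (poleWeight r (zPart Θ) * poleWeight r (wPart Θ)) ^ q ∂μHE[2 * (l + n + m)]
        ≤ K * ENNReal.ofReal (r ^ (2 * (l + n + m : ℕ) - 4 * (q - 1))) := by
  obtain ⟨K, hK⟩ := exists_setLIntegral_HNPiece_chart_le (l := l) p p' j j'
    (zero_le_one.trans hq1) hq2
  obtain ⟨C, hC, hC0⟩ : ∃ C : ℝ, C = 16 * (n + 1 : ℕ) ^ 4 * (16 * (m + 1 : ℕ) ^ 4) ∧ 0 ≤ C :=
    ⟨_, rfl, by positivity⟩
  refine ⟨C.toNNReal * K, fun Z r hr hr4 => ?_⟩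
  have hmeas : Measurable fun Θ : Amb l n m => ∏ i, poleWeight r (chart p p' Θ i) ^ q :=
    (measurable_prod_poleWeight r q).comp measurable_chart
  have hconst : 16 * (n + 1 : ℕ) ^ 4 * r ^ (-(2 * (q - 1)))
      * (16 * (m + 1 : ℕ) ^ 4 * r ^ (-(2 * (q - 1)))) = C * r ^ (-(4 * (q - 1))) := by
    rw [mul_mul_mul_comm, ← Real.rpow_add hr, hC]
    ring_nf
  have hpow : r ^ (2 * (l + n + m : ℕ) - 4 * (q - 1))
      = r ^ (-(4 * (q - 1))) * r ^ (2 * (l + n + m)) := by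
    rw [← Real.rpow_natCast, ← Real.rpow_add hr]
    push_cast
    ring_nf
  calc ∫⁻ Θ in HNPiece l p p' j j' ∩ (ball 0 1 ∩ ball Z r), ENNReal.ofReal (wt Θ ^ (2 * (q - 1)))
          * (poleWeight r (zPart Θ) * poleWeight r (wPart Θ)) ^ q ∂μHE[2 * (l + n + m)]
      ≤ ∫⁻ Θ in HNPiece l p p' j j' ∩ (ball 0 1 ∩ ball Z r),
          ENNReal.ofReal (C * r ^ (-(4 * (q - 1)))) * ∏ i, poleWeight r (chart p p' Θ i) ^ q
            ∂μHE[2 * (l + n + m)] :=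
        setLIntegral_mono (hmeas.const_mul _) fun Θ hΘ => by
          rw [← hconst]
          exact wt_rpow_mul_poleWeight_rpow_le_prod hΘ.1 (mem_ball_zero_iff.1 hΘ.2.1).le hq1 hq2.le
            hr hr4
    _ ≤ ENNReal.ofReal (C * r ^ (-(4 * (q - 1))))
          * ∫⁻ Θ in HNPiece l p p' j j' ∩ ball Z r, ∏ i, poleWeight r (chart p p' Θ i) ^ q
            ∂μHE[2 * (l + n + m)] := by
        rw [lintegral_const_mul _ hmeas]
        gcongr
        exact Set.inter_subset_right
    _ ≤ ENNReal.ofReal (C * r ^ (-(4 * (q - 1))))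
          * (K * ENNReal.ofReal (r ^ (2 * (l + n + m)))) := by
        gcongr
        exact hK Z r hr
    _ = _ := by
        rw [hpow, ENNReal.ofReal_mul (by positivity), ENNReal.ofReal_mul (by positivity),
          ENNReal.coe_mul, ← ENNReal.ofReal.eq_1]
        ring

/-- Each of the two cone factors costs `r ^ (-2 (q - 1))` against the Lebesgue volume of a ball. -/
theorem exists_setLIntegral_ball_weightedVolume_le (l n m : ℕ) (hq1 : 1 ≤ q) (hq2 : q < 2) :
    ∃ K : NNReal, ∀ (Z : Amb l n m) (r : ℝ), 0 < r → r ≤ 4 →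
      ∫⁻ Θ in ball Z r, (poleWeight r (zPart Θ) * poleWeight r (wPart Θ)) ^ q
          ∂weightedVolume l n m q
        ≤ K * ENNReal.ofReal (r ^ (2 * (l + n + m : ℕ) - 4 * (q - 1))) := by
  choose K hK using fun t : (Fin (n + 1) × Fin 4) × (Fin (m + 1) × Fin 4) =>
    exists_setLIntegral_HNPiece_wt_le (l := l) t.1.1 t.2.1 t.1.2 t.2.2 hq1 hq2
  refine ⟨∑ t, K t, fun Z r hr hr4 => ?_⟩
  have hcover : ball Z r ∩ MN l n m ∩ HN l n m ⊆
      ⋃ t : (Fin (n + 1) × Fin 4) × (Fin (m + 1) × Fin 4),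
        HNPiece l t.1.1 t.2.1 t.1.2 t.2.2 ∩ (ball 0 1 ∩ ball Z r) := by
    rintro Θ ⟨⟨hΘZ, -, hΘ1⟩, hz0, hw0, hz, hw⟩
    obtain ⟨s, hs⟩ := exists_mem_conePiece hz0 hz
    obtain ⟨s', hs'⟩ := exists_mem_conePiece hw0 hw
    exact Set.mem_iUnion.2 ⟨(s, s'), ⟨hs, hs'⟩, hΘ1, hΘZ⟩
  calc ∫⁻ Θ in ball Z r, (poleWeight r (zPart Θ) * poleWeight r (wPart Θ)) ^ q
          ∂weightedVolume l n m q
      = ∫⁻ Θ in ball Z r ∩ MN l n m ∩ HN l n m, ENNReal.ofReal (wt Θ ^ (2 * (q - 1)))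
          * (poleWeight r (zPart Θ) * poleWeight r (wPart Θ)) ^ q ∂μHE[2 * (l + n + m)] := by
        rw [weightedVolume, setLIntegral_withDensity_eq_setLIntegral_mul_non_measurable _
          (measurable_ofReal_wt_rpow _) _ measurableSet_ball
          (.of_forall fun _ => ENNReal.ofReal_lt_top),
          Measure.restrict_restrict measurableSet_ball, dV,
          Measure.restrict_restrict (measurableSet_ball.inter measurableSet_MN)]
        rfl
    _ ≤ ∑ t : (Fin (n + 1) × Fin 4) × (Fin (m + 1) × Fin 4),
          ∫⁻ Θ in HNPiece l t.1.1 t.2.1 t.1.2 t.2.2 ∩ (ball 0 1 ∩ ball Z r),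
            ENNReal.ofReal (wt Θ ^ (2 * (q - 1)))
              * (poleWeight r (zPart Θ) * poleWeight r (wPart Θ)) ^ q ∂μHE[2 * (l + n + m)] := by
        rw [← tsum_fintype (L := .unconditional _)]
        exact (lintegral_mono_set hcover).trans (lintegral_iUnion_le _ _)
    _ ≤ ∑ t, K t * ENNReal.ofReal (r ^ (2 * (l + n + m : ℕ) - 4 * (q - 1))) :=
        Finset.sum_le_sum fun t _ => hK t Z r hr hr4
    _ = _ := by rw [← Finset.sum_mul, ENNReal.ofNNReal_finsetSum]

end VolumeGrowth

section Blocks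

variable {k : ℕ} {ζ z z' : EuclideanSpace ℂ (Fin k)} {M : ℝ}

theorem norm_bdot_le (a b : EuclideanSpace ℂ (Fin k)) : ‖bdot a b‖ ≤ ‖a‖ * ‖b‖ := by
  have hinner : bdot a b = inner ℂ (conjVec a) b := by
    simp [bdot, conjVec, PiLp.inner_apply, mul_comm]
  have hnorm : ‖conjVec a‖ = ‖a‖ := by simp [EuclideanSpace.norm_eq, conjVec]
  rw [hinner, ← hnorm]
  exact norm_inner_le_norm _ _

theorem norm_bdot_conjVec_le (a b : EuclideanSpace ℂ (Fin k)) :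
    ‖bdot a (conjVec b)‖ ≤ ‖a‖ * ‖b‖ := by
  have hnorm : ‖conjVec b‖ = ‖b‖ := by simp [EuclideanSpace.norm_eq, conjVec]
  rw [← hnorm]
  exact norm_bdot_le _ _

theorem bdot_sub_left (a a' b : EuclideanSpace ℂ (Fin k)) :
    bdot (a - a') b = bdot a b - bdot a' b := by
  simp [bdot, sub_mul]

theorem bdot_sub_right (a b b' : EuclideanSpace ℂ (Fin k)) :
    bdot a (b - b') = bdot a b - bdot a b' := by
  simp [bdot, mul_sub]

/-- The common size, up to constants, of `fac ζ z` and of `comp ζ z / M` for `z` at distance at most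
`M` from `ζ`. -/
def blockSize (ζ : EuclideanSpace ℂ (Fin k)) (M : ℝ) : ℝ := ‖ζ‖ * (‖ζ‖ + M)

theorem blockSize_nonneg (ζ : EuclideanSpace ℂ (Fin k)) (hM : 0 ≤ M) : 0 ≤ blockSize ζ M := by
  unfold blockSize
  positivity

theorem blockSize_two_mul_le (ζ : EuclideanSpace ℂ (Fin k)) (M : ℝ) :
    blockSize ζ (2 * M) ≤ 2 * blockSize ζ M := by
  rw [blockSize, blockSize]
  linarith [mul_self_nonneg ‖ζ‖]

theorem mul_norm_le_blockSize (ζ : EuclideanSpace ℂ (Fin k)) (M : ℝ) :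
    M * ‖ζ‖ ≤ blockSize ζ M := by
  rw [blockSize]
  linarith [mul_self_nonneg ‖ζ‖]

theorem norm_mul_two_mul_add_le_blockSize (ζ : EuclideanSpace ℂ (Fin k)) (hM : 0 ≤ M) :
    ‖ζ‖ * (2 * ‖ζ‖ + M) ≤ 2 * blockSize ζ M := by
  rw [blockSize]
  linarith [mul_nonneg (norm_nonneg ζ) hM]

theorem norm_fac_le (hM : ‖ζ - z‖ ≤ M) : ‖fac ζ z‖ ≤ 2 * blockSize ζ M := by
  have hz : ‖z‖ ≤ ‖ζ‖ + M :=
    calc ‖z‖ ≤ ‖ζ‖ + ‖ζ - z‖ := norm_le_norm_add_norm_sub _ _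
      _ ≤ ‖ζ‖ + M := by gcongr
  calc ‖fac ζ z‖ ≤ ‖(‖ζ‖ : ℂ) ^ 2‖ + ‖bdot z (conjVec ζ)‖ := norm_add_le _ _
    _ ≤ ‖ζ‖ ^ 2 + (‖ζ‖ + M) * ‖ζ‖ := by
        gcongr
        · simp
        · exact (norm_bdot_conjVec_le z ζ).trans (by gcongr)
    _ = ‖ζ‖ * (2 * ‖ζ‖ + M) := by ring
    _ ≤ 2 * blockSize ζ M := norm_mul_two_mul_add_le_blockSize ζ ((norm_nonneg _).trans hM)

theorem norm_fac_sub_le (ζ z z' : EuclideanSpace ℂ (Fin k)) :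
    ‖fac ζ z - fac ζ z'‖ ≤ ‖z - z'‖ * ‖ζ‖ := by
  have hsub : fac ζ z - fac ζ z' = bdot (z - z') (conjVec ζ) := by
    rw [bdot_sub_left, fac, fac, add_sub_add_left_eq_sub]
  rw [hsub]
  exact norm_bdot_conjVec_le _ _

theorem mul_norm_fac_sub_le {δ : ℝ} (hM : 0 ≤ M) (hδ : ‖z - z'‖ ≤ δ) :
    M * ‖fac ζ z - fac ζ z'‖ ≤ δ * blockSize ζ M :=
  calc M * ‖fac ζ z - fac ζ z'‖ ≤ M * (δ * ‖ζ‖) := by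
        gcongr
        exact (norm_fac_sub_le ζ z z').trans (by gcongr)
    _ = δ * (M * ‖ζ‖) := by ring
    _ ≤ δ * blockSize ζ M :=
        mul_le_mul_of_nonneg_left (mul_norm_le_blockSize ζ M) ((norm_nonneg _).trans hδ)

theorem comp_eq_of_bdot_self_eq_zero (hz : bdot z z = 0) (j : Fin k) :
    comp ζ z j = (starRingEnd ℂ) (z j - ζ j) * fac ζ z
      - (z j + ζ j) * (starRingEnd ℂ) (bdot z ζ) := by
  rw [comp, fac, bdot_sub_right, hz, sub_zero, map_sub, add_comm (bdot z _)]

theorem norm_bdot_le_of_bdot_self_eq_zero (hζ : bdot ζ ζ = 0) (hM : ‖ζ - z‖ ≤ M) :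
    ‖bdot z ζ‖ ≤ M * ‖ζ‖ := by
  have hsub : bdot z ζ = bdot (z - ζ) ζ := by rw [bdot_sub_left, hζ, sub_zero]
  rw [norm_sub_rev] at hM
  rw [hsub]
  exact (norm_bdot_le _ _).trans (by gcongr)

theorem norm_apply_sub_le (hM : ‖ζ - z‖ ≤ M) (j : Fin k) : ‖z j - ζ j‖ ≤ M := by
  rw [norm_sub_rev]
  exact (PiLp.norm_apply_le (ζ - z) j).trans hM

theorem norm_apply_add_le (hM : ‖ζ - z‖ ≤ M) (j : Fin k) : ‖z j + ζ j‖ ≤ 2 * ‖ζ‖ + M :=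
  calc ‖z j + ζ j‖ = ‖2 * ζ j + (z j - ζ j)‖ := by ring_nf
    _ ≤ 2 * ‖ζ j‖ + ‖z j - ζ j‖ := (norm_add_le _ _).trans_eq (by simp)
    _ ≤ 2 * ‖ζ‖ + M := by
        gcongr
        · exact PiLp.norm_apply_le ζ j
        · exact norm_apply_sub_le hM j

theorem norm_comp_le (hζ : bdot ζ ζ = 0) (hz : bdot z z = 0) (hM : ‖ζ - z‖ ≤ M) (j : Fin k) :
    ‖comp ζ z j‖ ≤ 4 * M * blockSize ζ M := by
  have hM0 : 0 ≤ M := (norm_nonneg _).trans hM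
  rw [comp_eq_of_bdot_self_eq_zero hz]
  calc _ ≤ ‖z j - ζ j‖ * ‖fac ζ z‖ + ‖z j + ζ j‖ * ‖bdot z ζ‖ :=
        (norm_sub_le _ _).trans_eq (by simp only [norm_mul, RCLike.norm_conj])
    _ ≤ M * (2 * blockSize ζ M) + (2 * ‖ζ‖ + M) * (M * ‖ζ‖) := by
        gcongr
        · exact norm_apply_sub_le hM j
        · exact norm_fac_le hM
        · exact norm_apply_add_le hM j
        · exact norm_bdot_le_of_bdot_self_eq_zero hζ hM
    _ = M * (2 * blockSize ζ M) + M * (‖ζ‖ * (2 * ‖ζ‖ + M)) := by ring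
    _ ≤ M * (2 * blockSize ζ M) + M * (2 * blockSize ζ M) := by
        gcongr _ + M * ?_
        exact norm_mul_two_mul_add_le_blockSize ζ hM0
    _ = 4 * M * blockSize ζ M := by ring

theorem norm_comp_sub_le {δ : ℝ} (hζ : bdot ζ ζ = 0) (hz : bdot z z = 0) (hz' : bdot z' z' = 0)
    (hM : ‖ζ - z‖ ≤ M) (hM' : ‖ζ - z'‖ ≤ M) (hδ : ‖z - z'‖ ≤ δ) (j : Fin k) :
    ‖comp ζ z j - comp ζ z' j‖ ≤ 5 * δ * blockSize ζ M := by
  have hM0 : 0 ≤ M := (norm_nonneg _).trans hM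
  have hδ0 : 0 ≤ δ := (norm_nonneg _).trans hδ
  have hδj : ‖z j - z' j‖ ≤ δ := (PiLp.norm_apply_le (z - z') j).trans hδ
  have hsub : comp ζ z j - comp ζ z' j
      = ((starRingEnd ℂ) (z j - z' j) * fac ζ z
          + (starRingEnd ℂ) (z' j - ζ j) * (fac ζ z - fac ζ z'))
        - ((z j - z' j) * (starRingEnd ℂ) (bdot z ζ)
          + (z' j + ζ j) * (starRingEnd ℂ) (bdot (z - z') ζ)) := by
    rw [comp_eq_of_bdot_self_eq_zero hz, comp_eq_of_bdot_self_eq_zero hz', bdot_sub_left]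
    simp only [map_sub]
    ring
  rw [hsub]
  calc _ ≤ (‖z j - z' j‖ * ‖fac ζ z‖ + ‖z' j - ζ j‖ * ‖fac ζ z - fac ζ z'‖)
          + (‖z j - z' j‖ * ‖bdot z ζ‖ + ‖z' j + ζ j‖ * ‖bdot (z - z') ζ‖) :=
        (norm_sub_le _ _).trans ((add_le_add (norm_add_le _ _) (norm_add_le _ _)).trans_eq
          (by simp only [norm_mul, RCLike.norm_conj]))
    _ ≤ (δ * (2 * blockSize ζ M) + M * (δ * ‖ζ‖))
          + (δ * (M * ‖ζ‖) + (2 * ‖ζ‖ + M) * (δ * ‖ζ‖)) := by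
        gcongr
        · exact norm_fac_le hM
        · exact norm_apply_sub_le hM' j
        · exact (norm_fac_sub_le ζ z z').trans (by gcongr)
        · exact norm_bdot_le_of_bdot_self_eq_zero hζ hM
        · exact norm_apply_add_le hM' j
        · exact (norm_bdot_le _ _).trans (by gcongr)
    _ ≤ 5 * δ * blockSize ζ M := by
        rw [blockSize]
        linarith [mul_nonneg hδ0 (sq_nonneg ‖ζ‖)]

end Blocks

section Coefficients

variable {l n m : ℕ} {Θ Z Z' : Amb l n m} {M : ℝ}

theorem norm_zPart_sub_le (Z Z' : Amb l n m) : ‖zPart Z - zPart Z'‖ ≤ ‖Z - Z'‖ :=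
  norm_zPart_le (Z - Z')

theorem norm_wPart_sub_le (Z Z' : Amb l n m) : ‖wPart Z - wPart Z'‖ ≤ ‖Z - Z'‖ :=
  norm_wPart_le (Z - Z')

theorem norm_conj_xPart_sub_le (Z Z' : Amb l n m) (i : Fin l) :
    ‖(starRingEnd ℂ) (xPart Z i) - (starRingEnd ℂ) (xPart Z' i)‖ ≤ ‖Z - Z'‖ := by
  rw [← map_sub, RCLike.norm_conj]
  exact PiLp.norm_apply_le (Z - Z') (Sum.inl i)

theorem norm_mul_sub_mul_le (a a' b b' : ℂ) :
    ‖a * b - a' * b'‖ ≤ ‖a - a'‖ * ‖b‖ + ‖a'‖ * ‖b - b'‖ :=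
  calc ‖a * b - a' * b'‖ = ‖(a - a') * b + a' * (b - b')‖ := by ring_nf
    _ ≤ _ := (norm_add_le _ _).trans_eq (by rw [norm_mul, norm_mul])

theorem norm_conj_sub_mul_fac_le (hM : ‖Θ - Z‖ ≤ M) (i : Fin l) :
    ‖((starRingEnd ℂ) (xPart Θ i) - (starRingEnd ℂ) (xPart Z i)) * fac (zPart Θ) (zPart Z)‖
      ≤ 4 * M * blockSize (zPart Θ) M := by
  have hM0 : 0 ≤ M := (norm_nonneg _).trans hM
  rw [norm_mul]
  calc _ ≤ M * (2 * blockSize (zPart Θ) M) := by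
        gcongr
        · exact (norm_conj_xPart_sub_le Θ Z i).trans hM
        · exact norm_fac_le ((norm_zPart_sub_le Θ Z).trans hM)
    _ ≤ 4 * M * blockSize (zPart Θ) M := by
        linarith [mul_nonneg hM0 (blockSize_nonneg (zPart Θ) hM0)]

theorem norm_conj_sub_mul_fac_sub_le (hM : ‖Θ - Z‖ ≤ M) (hM' : ‖Θ - Z'‖ ≤ M) (i : Fin l) :
    ‖((starRingEnd ℂ) (xPart Θ i) - (starRingEnd ℂ) (xPart Z i)) * fac (zPart Θ) (zPart Z)
        - ((starRingEnd ℂ) (xPart Θ i) - (starRingEnd ℂ) (xPart Z' i)) * fac (zPart Θ) (zPart Z')‖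
      ≤ 5 * ‖Z - Z'‖ * blockSize (zPart Θ) M := by
  have hM0 : 0 ≤ M := (norm_nonneg _).trans hM
  refine (norm_mul_sub_mul_le _ _ _ _).trans ?_
  rw [sub_sub_sub_cancel_left, norm_sub_rev]
  calc _ ≤ ‖Z - Z'‖ * (2 * blockSize (zPart Θ) M)
          + M * ‖fac (zPart Θ) (zPart Z) - fac (zPart Θ) (zPart Z')‖ := by
        gcongr
        · exact norm_conj_xPart_sub_le Z Z' i
        · exact norm_fac_le ((norm_zPart_sub_le Θ Z).trans hM)
        · exact (norm_conj_xPart_sub_le Θ Z' i).trans hM'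
    _ ≤ ‖Z - Z'‖ * (2 * blockSize (zPart Θ) M) + ‖Z - Z'‖ * blockSize (zPart Θ) M := by
        gcongr _ + ?_
        exact mul_norm_fac_sub_le hM0 (norm_zPart_sub_le Z Z')
    _ ≤ 5 * ‖Z - Z'‖ * blockSize (zPart Θ) M := by
        linarith [mul_nonneg (norm_nonneg (Z - Z')) (blockSize_nonneg (zPart Θ) hM0)]

theorem norm_mul_mul_le_of_le {a b : ℂ} (γ : ℂ) {S T : ℝ} (ha : ‖a‖ ≤ 4 * M * S)
    (hb : ‖b‖ ≤ 2 * T) : ‖γ * a * b‖ ≤ ‖γ‖ * (8 * M * (S * T)) :=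
  calc ‖γ * a * b‖ = ‖γ‖ * (‖a‖ * ‖b‖) := by rw [norm_mul, norm_mul, mul_assoc]
    _ ≤ ‖γ‖ * (4 * M * S * (2 * T)) :=
        mul_le_mul_of_nonneg_left (mul_le_mul ha hb (norm_nonneg b) ((norm_nonneg a).trans ha))
          (norm_nonneg γ)
    _ = ‖γ‖ * (8 * M * (S * T)) := by ring

theorem norm_mul_mul_sub_le_of_le {a a' b b' : ℂ} (γ : ℂ) {δ S T : ℝ} (hS : 0 ≤ S)
    (hd : ‖a - a'‖ ≤ 5 * δ * S) (ha' : ‖a'‖ ≤ 4 * M * S) (hb : ‖b‖ ≤ 2 * T)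
    (hdb : M * ‖b - b'‖ ≤ δ * T) :
    ‖γ * a * b - γ * a' * b'‖ ≤ ‖γ‖ * (14 * δ * (S * T)) := by
  rw [mul_assoc, mul_assoc, ← mul_sub, norm_mul]
  gcongr
  calc ‖a * b - a' * b'‖ ≤ ‖a - a'‖ * ‖b‖ + ‖a'‖ * ‖b - b'‖ := norm_mul_sub_mul_le _ _ _ _
    _ ≤ 5 * δ * S * (2 * T) + 4 * M * S * ‖b - b'‖ :=
        add_le_add (mul_le_mul hd hb (norm_nonneg b) ((norm_nonneg _).trans hd)) (by gcongr)
    _ = 10 * δ * (S * T) + 4 * S * (M * ‖b - b'‖) := by ring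
    _ ≤ 10 * δ * (S * T) + 4 * S * (δ * T) := by gcongr
    _ = 14 * δ * (S * T) := by ring

theorem norm_B_le (c : Idx l n m → ℂ) (hΘ : Θ ∈ HN l n m) (hZ : Z ∈ HN l n m)
    (hM : ‖Θ - Z‖ ≤ M) (j : Idx l n m) :
    ‖B c Θ Z j‖
      ≤ ‖c j‖ * (8 * M * (blockSize (zPart Θ) M * blockSize (wPart Θ) M)) := by
  obtain ⟨-, -, hΘz, hΘw⟩ := hΘ
  obtain ⟨-, -, hZz, hZw⟩ := hZ
  have hMz := (norm_zPart_sub_le Θ Z).trans hM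
  have hMw := (norm_wPart_sub_le Θ Z).trans hM
  obtain i | i | i := j
  · simp only [B, mul_assoc (c _) (_ - _)]
    exact norm_mul_mul_le_of_le _ (norm_conj_sub_mul_fac_le hM i) (norm_fac_le hMw)
  · exact norm_mul_mul_le_of_le _ (norm_comp_le hΘz hZz hMz i) (norm_fac_le hMw)
  · rw [mul_comm (blockSize _ _)]
    exact norm_mul_mul_le_of_le _ (norm_comp_le hΘw hZw hMw i) (norm_fac_le hMz)

theorem norm_B_sub_le (c : Idx l n m → ℂ) (hΘ : Θ ∈ HN l n m) (hZ : Z ∈ HN l n m)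
    (hZ' : Z' ∈ HN l n m) (hM : ‖Θ - Z‖ ≤ M) (hM' : ‖Θ - Z'‖ ≤ M) (j : Idx l n m) :
    ‖B c Θ Z j - B c Θ Z' j‖
      ≤ ‖c j‖ * (14 * ‖Z - Z'‖ * (blockSize (zPart Θ) M * blockSize (wPart Θ) M)) := by
  have hM0 : 0 ≤ M := (norm_nonneg _).trans hM
  obtain ⟨-, -, hΘz, hΘw⟩ := hΘ
  obtain ⟨-, -, hZz, hZw⟩ := hZ
  obtain ⟨-, -, hZz', hZw'⟩ := hZ'
  have hMz := (norm_zPart_sub_le Θ Z).trans hM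
  have hMw := (norm_wPart_sub_le Θ Z).trans hM
  have hMz' := (norm_zPart_sub_le Θ Z').trans hM'
  have hMw' := (norm_wPart_sub_le Θ Z').trans hM'
  have hδz := norm_zPart_sub_le Z Z'
  have hδw := norm_wPart_sub_le Z Z'
  obtain i | i | i := j
  · simp only [B, mul_assoc (c _) (_ - _)]
    exact norm_mul_mul_sub_le_of_le _ (blockSize_nonneg _ hM0)
      (norm_conj_sub_mul_fac_sub_le hM hM' i) (norm_conj_sub_mul_fac_le hM' i) (norm_fac_le hMw)
      (mul_norm_fac_sub_le hM0 hδw)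
  · exact norm_mul_mul_sub_le_of_le _ (blockSize_nonneg _ hM0)
      (norm_comp_sub_le hΘz hZz hZz' hMz hMz' hδz i) (norm_comp_le hΘz hZz' hMz' i)
      (norm_fac_le hMw) (mul_norm_fac_sub_le hM0 hδw)
  · rw [mul_comm (blockSize _ _)]
    exact norm_mul_mul_sub_le_of_le _ (blockSize_nonneg _ hM0)
      (norm_comp_sub_le hΘw hZw hZw' hMw hMw' hδw i) (norm_comp_le hΘw hZw' hMw' i)
      (norm_fac_le hMz) (mul_norm_fac_sub_le hM0 hδz)

end Coefficients

section Kernel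

variable {l n m : ℕ} {Θ Z Z' : Amb l n m} {ρ : ℝ}

/-- The size of the Martinelli–Bochner kernel at `Z`: the sum of the moduli of its coefficients,
with the weight `1 / (|ζ|² |η|²)` of `Δ`. -/
def kernelSize (c : Idx l n m → ℂ) (Θ Z : Amb l n m) : ℝ :=
  1 / (‖zPart Θ‖ ^ 2 * ‖wPart Θ‖ ^ 2) *
    ∑ j : Idx l n m, ‖B c Θ Z j / ((‖Θ - Z‖ ^ (2 * (l + n + m)) : ℝ) : ℂ)‖

theorem measurable_kernelSize (c : Idx l n m → ℂ) (Z : Amb l n m) :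
    Measurable fun Θ => kernelSize c Θ Z := by
  have hB (j : Idx l n m) : Continuous fun Θ => B c Θ Z j := by
    obtain i | i | i := j <;> simp only [B, comp, fac, bdot, conjVec, xPart] <;> fun_prop
  unfold kernelSize
  fun_prop

theorem kernelSize_self (c : Idx l n m → ℂ) (hZ : Z ∈ HN l n m) : kernelSize c Z Z = 0 := by
  have hB (j : Idx l n m) : B c Z Z j = 0 := by
    simpa using norm_B_le c hZ hZ (M := 0) (by simp) j
  simp [kernelSize, hB]

theorem Δ_self (c : Idx l n m → ℂ) (Θ Z : Amb l n m) : Δ c Θ Z Z = 0 := by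
  simp [Δ]

theorem Δ_nonneg (c : Idx l n m → ℂ) (Θ Z Z' : Amb l n m) : 0 ≤ Δ c Θ Z Z' := by
  unfold Δ
  positivity

theorem Δ_le_kernelSize_add_kernelSize (c : Idx l n m → ℂ) (Θ Z Z' : Amb l n m) :
    Δ c Θ Z Z' ≤ kernelSize c Θ Z + kernelSize c Θ Z' := by
  rw [Δ, kernelSize, kernelSize, ← mul_add, ← Finset.sum_add_distrib]
  gcongr
  exact norm_sub_le _ _

theorem ofReal_blockSize_mul_blockSize_div (hΘ : Θ ∈ HN l n m) (hρ : 0 ≤ ρ) :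
    ENNReal.ofReal (blockSize (zPart Θ) ρ * blockSize (wPart Θ) ρ
        / (‖zPart Θ‖ ^ 2 * ‖wPart Θ‖ ^ 2))
      = poleWeight ρ (zPart Θ) * poleWeight ρ (wPart Θ) := by
  obtain ⟨hz, hw, -⟩ := hΘ
  have hz' : ‖zPart Θ‖ ≠ 0 := norm_ne_zero_iff.2 hz
  have hw' : ‖wPart Θ‖ ≠ 0 := norm_ne_zero_iff.2 hw
  rw [← ofReal_one_add_div_norm hρ hz, ← ofReal_one_add_div_norm hρ hw,
    ← ENNReal.ofReal_mul (by positivity), blockSize, blockSize]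
  congr 1
  field_simp

theorem ofReal_weighted_sum_le (hΘ : Θ ∈ HN l n m) (hρ : 0 ≤ ρ) {A : ℝ} (hA : 0 ≤ A)
    (c : Idx l n m → ℂ) {F : Idx l n m → ℝ}
    (hF : ∀ j, F j ≤ ‖c j‖ * (A * (blockSize (zPart Θ) ρ * blockSize (wPart Θ) ρ))) :
    ENNReal.ofReal (1 / (‖zPart Θ‖ ^ 2 * ‖wPart Θ‖ ^ 2) * ∑ j, F j)
      ≤ ENNReal.ofReal ((∑ j, ‖c j‖) * A) * (poleWeight ρ (zPart Θ) * poleWeight ρ (wPart Θ)) := by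
  rw [← ofReal_blockSize_mul_blockSize_div hΘ hρ, ← ENNReal.ofReal_mul (by positivity)]
  refine ENNReal.ofReal_le_ofReal ?_
  calc 1 / (‖zPart Θ‖ ^ 2 * ‖wPart Θ‖ ^ 2) * ∑ j, F j
      ≤ 1 / (‖zPart Θ‖ ^ 2 * ‖wPart Θ‖ ^ 2)
          * ∑ j, ‖c j‖ * (A * (blockSize (zPart Θ) ρ * blockSize (wPart Θ) ρ)) := by
        gcongr with j
        exact hF j
    _ = _ := by
        rw [← Finset.sum_mul]
        ring

theorem ofReal_kernelSize_le (c : Idx l n m → ℂ) (hΘ : Θ ∈ HN l n m) (hZ : Z ∈ HN l n m)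
    (hρ : 0 < ρ) (hΘZ : ‖Θ - Z‖ ∈ Set.Ico (ρ / 2) ρ) :
    ENNReal.ofReal (kernelSize c Θ Z)
      ≤ ENNReal.ofReal ((∑ j, ‖c j‖) * (8 * ρ / (ρ / 2) ^ (2 * (l + n + m))))
        * (poleWeight ρ (zPart Θ) * poleWeight ρ (wPart Θ)) := by
  refine ofReal_weighted_sum_le hΘ hρ.le (by positivity) c fun j => ?_
  have hz := blockSize_nonneg (zPart Θ) hρ.le
  have hw := blockSize_nonneg (wPart Θ) hρ.le
  rw [norm_div, Complex.norm_real, Real.norm_of_nonneg (by positivity)]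
  calc ‖B c Θ Z j‖ / ‖Θ - Z‖ ^ (2 * (l + n + m))
      ≤ ‖c j‖ * (8 * ρ * (blockSize (zPart Θ) ρ * blockSize (wPart Θ) ρ))
          / (ρ / 2) ^ (2 * (l + n + m)) := by
        gcongr
        · exact norm_B_le c hΘ hZ hΘZ.2.le j
        · exact hΘZ.1
    _ = _ := by ring

theorem abs_inv_pow_sub_inv_pow_le {a R R' δ : ℝ} (ha : 0 < a) (hR : a ≤ R) (hR' : a ≤ R')
    (hδ : |R - R'| ≤ δ) (D : ℕ) :
    |(R ^ D)⁻¹ - (R' ^ D)⁻¹| ≤ D * δ / a ^ (D + 1) := by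
  have hRpos : 0 < R := ha.trans_le hR
  have hRpos' : 0 < R' := ha.trans_le hR'
  have hδ0 : 0 ≤ δ := (abs_nonneg _).trans hδ
  obtain - | D := D
  · simp
  have hinv : |R⁻¹ - R'⁻¹| ≤ δ / (a * a) := by
    rw [inv_sub_inv hRpos.ne' hRpos'.ne', abs_div, abs_sub_comm, abs_of_pos (mul_pos hRpos hRpos')]
    gcongr
  have hmax : max |R⁻¹| |R'⁻¹| ≤ a⁻¹ := by
    rw [abs_of_pos (inv_pos.2 hRpos), abs_of_pos (inv_pos.2 hRpos')]
    exact max_le (by gcongr) (by gcongr)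
  calc |(R ^ (D + 1))⁻¹ - (R' ^ (D + 1))⁻¹|
      ≤ |R⁻¹ - R'⁻¹| * (D + 1 : ℕ) * max |R⁻¹| |R'⁻¹| ^ D := by
        rw [← inv_pow, ← inv_pow]
        exact abs_pow_sub_pow_le _ _ _
    _ ≤ δ / (a * a) * (D + 1 : ℕ) * a⁻¹ ^ D := by gcongr
    _ = (D + 1 : ℕ) * δ / a ^ (D + 1 + 1) := by
        rw [inv_pow]
        field_simp
        ring

theorem norm_div_sub_div_le (b b' : ℂ) (s s' : ℝ) :
    ‖b / (s : ℂ) - b' / (s' : ℂ)‖ ≤ ‖b - b'‖ * |s⁻¹| + ‖b'‖ * |s⁻¹ - s'⁻¹| := by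
  have hsub : b / (s : ℂ) - b' / (s' : ℂ)
      = (b - b') * ((s⁻¹ : ℝ) : ℂ) + b' * ((s⁻¹ - s'⁻¹ : ℝ) : ℂ) := by
    push_cast
    ring
  rw [hsub]
  refine (norm_add_le _ _).trans_eq ?_
  rw [norm_mul, norm_mul, Complex.norm_real, Complex.norm_real, Real.norm_eq_abs, Real.norm_eq_abs]

theorem norm_B_div_sub_B_div_le (c : Idx l n m → ℂ) (hΘ : Θ ∈ HN l n m) (hZ : Z ∈ HN l n m)
    (hZ' : Z' ∈ HN l n m) (hρ : 0 < ρ) (hΘZ : ‖Θ - Z‖ ∈ Set.Ico (ρ / 2) ρ)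
    (hZZ' : 4 * ‖Z - Z'‖ ≤ ρ) (j : Idx l n m) (D : ℕ) :
    ‖B c Θ Z j / ((‖Θ - Z‖ ^ D : ℝ) : ℂ) - B c Θ Z' j / ((‖Θ - Z'‖ ^ D : ℝ) : ℂ)‖
      ≤ ‖c j‖ * ((56 + 256 * D) * ‖Z - Z'‖ / (ρ / 4) ^ D
        * (blockSize (zPart Θ) ρ * blockSize (wPart Θ) ρ)) := by
  have hd : |‖Θ - Z‖ - ‖Θ - Z'‖| ≤ ‖Z - Z'‖ := by
    simpa [norm_sub_rev] using abs_norm_sub_norm_le (Θ - Z) (Θ - Z')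
  obtain ⟨hd1, hd2⟩ := abs_le.1 hd
  obtain ⟨h1, h2⟩ := hΘZ
  have hM : ‖Θ - Z‖ ≤ 2 * ρ := by linarith
  have hM' : ‖Θ - Z'‖ ≤ 2 * ρ := by linarith
  have hz := blockSize_nonneg (zPart Θ) hρ.le
  have hw := blockSize_nonneg (wPart Θ) hρ.le
  have hS : blockSize (zPart Θ) (2 * ρ) * blockSize (wPart Θ) (2 * ρ)
      ≤ 2 * blockSize (zPart Θ) ρ * (2 * blockSize (wPart Θ) ρ) :=
    mul_le_mul (blockSize_two_mul_le _ _) (blockSize_two_mul_le _ _)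
      (blockSize_nonneg _ (by positivity)) (by positivity)
  have hinv : |(‖Θ - Z‖ ^ D)⁻¹| ≤ ((ρ / 4) ^ D)⁻¹ := by
    rw [abs_of_nonneg (by positivity)]
    gcongr
    linarith
  calc _ ≤ ‖B c Θ Z j - B c Θ Z' j‖ * |(‖Θ - Z‖ ^ D)⁻¹|
          + ‖B c Θ Z' j‖ * |(‖Θ - Z‖ ^ D)⁻¹ - (‖Θ - Z'‖ ^ D)⁻¹| := norm_div_sub_div_le _ _ _ _
    _ ≤ ‖c j‖ * (14 * ‖Z - Z'‖ * (2 * blockSize (zPart Θ) ρ * (2 * blockSize (wPart Θ) ρ)))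
            * ((ρ / 4) ^ D)⁻¹
          + ‖c j‖ * (8 * (2 * ρ) * (2 * blockSize (zPart Θ) ρ * (2 * blockSize (wPart Θ) ρ)))
            * (D * ‖Z - Z'‖ / (ρ / 4) ^ (D + 1)) := by
        gcongr
        · exact (norm_B_sub_le c hΘ hZ hZ' hM hM' j).trans (by gcongr)
        · exact (norm_B_le c hΘ hZ' hM' j).trans (by gcongr)
        · exact abs_inv_pow_sub_inv_pow_le (by positivity) (by linarith) (by linarith) hd D
    _ = _ := by
        rw [pow_succ]
        field_simp
        ring

theorem ofReal_Δ_le (c : Idx l n m → ℂ) (hΘ : Θ ∈ HN l n m) (hZ : Z ∈ HN l n m)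
    (hZ' : Z' ∈ HN l n m) (hρ : 0 < ρ) (hΘZ : ‖Θ - Z‖ ∈ Set.Ico (ρ / 2) ρ)
    (hZZ' : 4 * ‖Z - Z'‖ ≤ ρ) :
    ENNReal.ofReal (Δ c Θ Z Z')
      ≤ ENNReal.ofReal ((∑ j, ‖c j‖) * ((56 + 256 * (2 * (l + n + m) : ℕ)) * ‖Z - Z'‖
          / (ρ / 4) ^ (2 * (l + n + m))))
        * (poleWeight ρ (zPart Θ) * poleWeight ρ (wPart Θ)) :=
  ofReal_weighted_sum_le hΘ hρ.le (by positivity) c fun j =>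
    norm_B_div_sub_B_div_le c hΘ hZ hZ' hρ hΘZ hZZ' j _

end Kernel

section Integrals

open Set Metric

variable {l n m : ℕ} {q : ℝ}

/-- The exponent `2|N| + 4 - (2|N| + 3) q` of `|Z - Z'|` in the estimate, with `|N| = l + n + m`. -/
def holderExponent (l n m : ℕ) (q : ℝ) : ℝ :=
  2 * ((l + n + m : ℕ) : ℝ) + 4 - (2 * ((l + n + m : ℕ) : ℝ) + 3) * q

theorem holderExponent_pos
    (hq : q < (2 * ((l + n + m : ℕ) : ℝ) + 4) / (2 * ((l + n + m : ℕ) : ℝ) + 3)) :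
    0 < holderExponent l n m q := by
  rw [lt_div_iff₀ (by positivity)] at hq
  rw [holderExponent]
  linarith

theorem lt_two_of_holderExponent_pos (hE : 0 < holderExponent l n m q) : q < 2 := by
  have hN : (0 : ℝ) ≤ (l + n + m : ℕ) := Nat.cast_nonneg _
  rw [holderExponent] at hE
  nlinarith

theorem holderExponent_one : holderExponent l n m 1 = 1 := by
  rw [holderExponent]
  ring

theorem norm_sub_lt_two {Θ Z : Amb l n m} (hΘ : Θ ∈ MN l n m) (hZ : Z ∈ MN l n m) :
    ‖Θ - Z‖ < 2 := by
  linarith [norm_sub_le Θ Z, mem_ball_zero_iff.1 hΘ.2, mem_ball_zero_iff.1 hZ.2]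

theorem setLIntegral_MN_ofReal_Δ_rpow_mul (c : Idx l n m → ℂ) (hq : 0 ≤ q) (Z Z' : Amb l n m) :
    ∫⁻ Θ in MN l n m, ENNReal.ofReal (Δ c Θ Z Z' ^ q * wt Θ ^ (2 * (q - 1))) ∂dV l n m
      = ∫⁻ Θ, ENNReal.ofReal (Δ c Θ Z Z') ^ q ∂weightedVolume l n m q := by
  rw [lintegral_weightedVolume]
  refine lintegral_congr fun Θ => ?_
  have hΔ := Δ_nonneg c Θ Z Z'
  rw [mul_comm, ENNReal.ofReal_mul' (by positivity), ENNReal.ofReal_rpow_of_nonneg hΔ hq]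

theorem exists_setLIntegral_shell_le (l n m : ℕ) (hq1 : 1 ≤ q) (hq2 : q < 2) :
    ∃ K : NNReal, ∀ Z ∈ MN l n m, ∀ ρ, 0 < ρ → ∀ (f : Amb l n m → ENNReal) (a : ℝ), 0 ≤ a →
      (∀ Θ ∈ HN l n m, ‖Θ - Z‖ ∈ Ico (ρ / 2) ρ →
        f Θ ≤ ENNReal.ofReal a * (poleWeight ρ (zPart Θ) * poleWeight ρ (wPart Θ))) →
      ∫⁻ Θ in (‖· - Z‖) ⁻¹' Ico (ρ / 2) ρ, f Θ ^ q ∂weightedVolume l n m q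
        ≤ K * ENNReal.ofReal (a ^ q * ρ ^ (2 * (l + n + m : ℕ) - 4 * (q - 1))) := by
  obtain ⟨K, hK⟩ := exists_setLIntegral_ball_weightedVolume_le l n m hq1 hq2
  have hq0 : 0 ≤ q := zero_le_one.trans hq1
  refine ⟨K, fun Z hZ ρ hρ f a ha hf => ?_⟩
  have hmem := ae_restrict_of_ae (s := (‖· - Z‖) ⁻¹' Ico (ρ / 2) ρ)
    (ae_mem_MN_weightedVolume (l := l) (n := n) (m := m) q)
  have hshell : MeasurableSet ((fun Θ : Amb l n m => ‖Θ - Z‖) ⁻¹' Ico (ρ / 2) ρ) :=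
    measurableSet_Ico.preimage (by fun_prop)
  have hball : (‖· - Z‖) ⁻¹' Ico (ρ / 2) ρ ⊆ ball Z ρ := fun Θ hΘ => mem_ball_iff_norm.2 hΘ.2
  have hmeas : Measurable fun Θ : Amb l n m =>
      (poleWeight ρ (zPart Θ) * poleWeight ρ (wPart Θ)) ^ q :=
    (((measurable_poleWeight ρ).comp measurable_zPart).mul
      ((measurable_poleWeight ρ).comp measurable_wPart)).pow_const q
  obtain hρ4 | hρ4 := le_or_gt ρ 4
  · calc _ ≤ ∫⁻ Θ in (‖· - Z‖) ⁻¹' Ico (ρ / 2) ρ, ENNReal.ofReal (a ^ q)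
              * (poleWeight ρ (zPart Θ) * poleWeight ρ (wPart Θ)) ^ q ∂weightedVolume l n m q := by
          refine lintegral_mono_ae ?_
          filter_upwards [hmem, ae_restrict_mem hshell] with Θ hΘ hΘZ
          rw [← ENNReal.ofReal_rpow_of_nonneg ha hq0, ← ENNReal.mul_rpow_of_nonneg _ _ hq0]
          exact ENNReal.rpow_le_rpow (hf Θ hΘ.1 hΘZ) hq0
      _ ≤ ENNReal.ofReal (a ^ q) * ∫⁻ Θ in ball Z ρ,
            (poleWeight ρ (zPart Θ) * poleWeight ρ (wPart Θ)) ^ q ∂weightedVolume l n m q := by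
          rw [lintegral_const_mul _ hmeas]
          gcongr
      _ ≤ ENNReal.ofReal (a ^ q)
            * (K * ENNReal.ofReal (ρ ^ (2 * (l + n + m : ℕ) - 4 * (q - 1)))) := by
          gcongr
          exact hK Z ρ hρ hρ4
      _ = _ := by rw [ENNReal.ofReal_mul (by positivity), mul_left_comm]
  · suffices h : (weightedVolume l n m q).restrict ((‖· - Z‖) ⁻¹' Ico (ρ / 2) ρ) = 0 by
      rw [h, lintegral_zero_measure]
      exact zero_le
    rw [← ae_eq_bot, ← Filter.eventually_false_iff_eq_bot]
    filter_upwards [hmem, ae_restrict_mem hshell] with Θ hΘ hΘZ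
    linarith [norm_sub_lt_two hΘ hZ, hΘZ.1]

theorem mul_div_div_pow_rpow {S b u ρ : ℝ} (hS : 0 ≤ S) (hb : 0 ≤ b) (hu : 0 < u) (hρ : 0 < ρ)
    (D : ℕ) : (S * (b / (ρ / u) ^ D)) ^ q = (S * u ^ D) ^ q * (b ^ q * ρ ^ (-(D * q))) := by
  have hρD : ρ ^ (-(D * q)) = (ρ ^ D)⁻¹ ^ q := by
    rw [Real.inv_rpow (by positivity), ← Real.rpow_natCast_mul hρ.le, Real.rpow_neg hρ.le]
  rw [hρD, ← Real.mul_rpow hb (by positivity), ← Real.mul_rpow (by positivity) (by positivity),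
    div_pow]
  congr 1
  field_simp

theorem exists_setLIntegral_shell_kernelSize_le (c : Idx l n m → ℂ) (hq1 : 1 ≤ q) (hq2 : q < 2) :
    ∃ K : NNReal, ∀ Z ∈ MN l n m, ∀ ρ, 0 < ρ →
      ∫⁻ Θ in (‖· - Z‖) ⁻¹' Ico (ρ / 2) ρ, ENNReal.ofReal (kernelSize c Θ Z) ^ q
          ∂weightedVolume l n m q
        ≤ K * ENNReal.ofReal (ρ ^ holderExponent l n m q) := by
  obtain ⟨K, hK⟩ := exists_setLIntegral_shell_le l n m hq1 hq2
  refine ⟨K * (((∑ j, ‖c j‖) * 8 * 2 ^ (2 * (l + n + m))) ^ q).toNNReal, fun Z hZ ρ hρ => ?_⟩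
  refine (hK Z hZ ρ hρ _ _ (by positivity)
    fun Θ hΘ hΘZ => ofReal_kernelSize_le c hΘ hZ.1 hρ hΘZ).trans_eq ?_
  have hexp : ρ ^ holderExponent l n m q = ρ ^ q * ρ ^ (-((2 * (l + n + m) : ℕ) * q))
      * ρ ^ (2 * (l + n + m : ℕ) - 4 * (q - 1)) := by
    rw [← Real.rpow_add hρ, ← Real.rpow_add hρ, holderExponent]
    push_cast
    ring_nf
  rw [mul_div_assoc 8, ← mul_assoc _ (8 : ℝ), mul_div_div_pow_rpow (by positivity) hρ.le two_pos hρ,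
    mul_assoc, ← hexp, ENNReal.ofReal_mul (by positivity), ENNReal.coe_mul, ← ENNReal.ofReal.eq_1]
  ring

theorem exists_setLIntegral_shell_Δ_le (c : Idx l n m → ℂ) (hq1 : 1 ≤ q) (hq2 : q < 2) :
    ∃ K : NNReal, ∀ Z ∈ MN l n m, ∀ Z' ∈ MN l n m, ∀ ρ, 0 < ρ → 4 * ‖Z - Z'‖ ≤ ρ →
      ∫⁻ Θ in (‖· - Z‖) ⁻¹' Ico (ρ / 2) ρ, ENNReal.ofReal (Δ c Θ Z Z') ^ q
          ∂weightedVolume l n m q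
        ≤ K * ENNReal.ofReal (‖Z - Z'‖ ^ q)
          * ENNReal.ofReal (ρ ^ ((2 * ((l + n + m : ℕ) : ℝ) + 4) * (1 - q))) := by
  obtain ⟨K, hK⟩ := exists_setLIntegral_shell_le l n m hq1 hq2
  refine ⟨K * (((∑ j, ‖c j‖) * (56 + 256 * (2 * (l + n + m) : ℕ))
    * 4 ^ (2 * (l + n + m))) ^ q).toNNReal, fun Z hZ Z' hZ' ρ hρ hρZ => ?_⟩
  refine (hK Z hZ ρ hρ _ _ (by positivity)
    fun Θ hΘ hΘZ => ofReal_Δ_le c hΘ hZ.1 hZ'.1 hρ hΘZ hρZ).trans_eq ?_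
  have hexp : ρ ^ ((2 * ((l + n + m : ℕ) : ℝ) + 4) * (1 - q))
      = ρ ^ (-((2 * (l + n + m) : ℕ) * q)) * ρ ^ (2 * (l + n + m : ℕ) - 4 * (q - 1)) := by
    rw [← Real.rpow_add hρ]
    push_cast
    ring_nf
  rw [mul_div_assoc, ← mul_assoc (∑ j, ‖c j‖),
    mul_div_div_pow_rpow (by positivity) (norm_nonneg _) four_pos hρ, mul_assoc (_ ^ q),
    mul_assoc (‖Z - Z'‖ ^ q), ← hexp, ENNReal.ofReal_mul (by positivity),
    ENNReal.ofReal_mul (by positivity), ENNReal.coe_mul, ← ENNReal.ofReal.eq_1]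
  ring

theorem exists_setLIntegral_ball_kernelSize_le (c : Idx l n m → ℂ) (hq1 : 1 ≤ q)
    (hE : 0 < holderExponent l n m q) :
    ∃ K : NNReal, ∀ Z ∈ MN l n m, ∀ r, 0 < r →
      ∫⁻ Θ in ball Z r, ENNReal.ofReal (kernelSize c Θ Z) ^ q ∂weightedVolume l n m q
        ≤ K * ENNReal.ofReal (r ^ holderExponent l n m q) := by
  obtain ⟨K, hK⟩ :=
    exists_setLIntegral_shell_kernelSize_le c hq1 (lt_two_of_holderExponent_pos hE)
  refine ⟨K * (1 - (1 / 2) ^ holderExponent l n m q : ℝ)⁻¹.toNNReal, fun Z hZ r hr => ?_⟩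
  have hcover : ball Z r ⊆ {Z} ∪ (‖· - Z‖) ⁻¹' Ioo 0 r := fun Θ hΘ => by
    obtain rfl | hΘZ := eq_or_ne Θ Z
    · exact .inl rfl
    · exact .inr ⟨norm_sub_pos_iff.2 hΘZ, mem_ball_iff_norm.1 hΘ⟩
  have hcenter :
      ∫⁻ Θ in {Z}, ENNReal.ofReal (kernelSize c Θ Z) ^ q ∂weightedVolume l n m q = 0 := by
    rw [lintegral_singleton, kernelSize_self c hZ.1, ENNReal.ofReal_zero,
      ENNReal.zero_rpow_of_pos (zero_lt_one.trans_le hq1), zero_mul]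
  calc ∫⁻ Θ in ball Z r, ENNReal.ofReal (kernelSize c Θ Z) ^ q ∂weightedVolume l n m q
      ≤ ∫⁻ Θ in {Z}, ENNReal.ofReal (kernelSize c Θ Z) ^ q ∂weightedVolume l n m q
        + ∫⁻ Θ in (‖· - Z‖) ⁻¹' Ioo 0 r, ENNReal.ofReal (kernelSize c Θ Z) ^ q
            ∂weightedVolume l n m q := (lintegral_mono_set hcover).trans (lintegral_union_le _ _ _)
    _ ≤ K * ENNReal.ofReal
          (r ^ holderExponent l n m q * (1 - (1 / 2) ^ holderExponent l n m q)⁻¹) := by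
        rw [hcenter, zero_add]
        exact setLIntegral_preimage_Ioo_le_of_shell hr hE fun ρ hρ _ => hK Z hZ ρ hρ
    _ = _ := by
        rw [ENNReal.ofReal_mul (by positivity), ENNReal.coe_mul, ← ENNReal.ofReal.eq_1]
        ring

theorem ofReal_Δ_rpow_le (hq1 : 1 ≤ q) (c : Idx l n m → ℂ) (Θ Z Z' : Amb l n m) :
    ENNReal.ofReal (Δ c Θ Z Z') ^ q
      ≤ 2 ^ (q - 1) * (ENNReal.ofReal (kernelSize c Θ Z) ^ q
        + ENNReal.ofReal (kernelSize c Θ Z') ^ q) :=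
  calc ENNReal.ofReal (Δ c Θ Z Z') ^ q
      ≤ (ENNReal.ofReal (kernelSize c Θ Z) + ENNReal.ofReal (kernelSize c Θ Z')) ^ q :=
        ENNReal.rpow_le_rpow ((ENNReal.ofReal_le_ofReal
          (Δ_le_kernelSize_add_kernelSize c Θ Z Z')).trans ENNReal.ofReal_add_le)
            (zero_le_one.trans hq1)
    _ ≤ _ := ENNReal.rpow_add_le_mul_rpow_add_rpow _ _ hq1

theorem exists_setLIntegral_ball_Δ_le (c : Idx l n m → ℂ) (hq1 : 1 ≤ q)
    (hE : 0 < holderExponent l n m q) :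
    ∃ K : NNReal, ∀ Z ∈ MN l n m, ∀ Z' ∈ MN l n m, Z ≠ Z' →
      ∫⁻ Θ in ball Z (2 * ‖Z - Z'‖), ENNReal.ofReal (Δ c Θ Z Z') ^ q ∂weightedVolume l n m q
        ≤ K * ENNReal.ofReal (‖Z - Z'‖ ^ holderExponent l n m q) := by
  obtain ⟨K, hK⟩ := exists_setLIntegral_ball_kernelSize_le c hq1 hE
  refine ⟨2 ^ (q - 1) * K * ((2 : ℝ) ^ holderExponent l n m q
    + (3 : ℝ) ^ holderExponent l n m q).toNNReal, fun Z hZ Z' hZ' hZZ' => ?_⟩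
  have hδ : 0 < ‖Z - Z'‖ := norm_sub_pos_iff.2 hZZ'
  have hmeas (Y : Amb l n m) : Measurable fun Θ => ENNReal.ofReal (kernelSize c Θ Y) ^ q :=
    (measurable_kernelSize c Y).ennreal_ofReal.pow_const q
  have hsum : Measurable fun Θ => ENNReal.ofReal (kernelSize c Θ Z) ^ q
      + ENNReal.ofReal (kernelSize c Θ Z') ^ q := (hmeas Z).add (hmeas Z')
  have hball : ball Z (2 * ‖Z - Z'‖) ⊆ ball Z' (3 * ‖Z - Z'‖) :=
    ball_subset_ball' (by rw [dist_eq_norm]; linarith)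
  calc _ ≤ 2 ^ (q - 1) * (∫⁻ Θ in ball Z (2 * ‖Z - Z'‖), ENNReal.ofReal (kernelSize c Θ Z) ^ q
            ∂weightedVolume l n m q
          + ∫⁻ Θ in ball Z (2 * ‖Z - Z'‖), ENNReal.ofReal (kernelSize c Θ Z') ^ q
            ∂weightedVolume l n m q) := by
        rw [← lintegral_add_left (hmeas Z), ← lintegral_const_mul _ hsum]
        exact lintegral_mono fun Θ => ofReal_Δ_rpow_le hq1 c Θ Z Z'
    _ ≤ 2 ^ (q - 1) * (K * ENNReal.ofReal ((2 * ‖Z - Z'‖) ^ holderExponent l n m q)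
          + K * ENNReal.ofReal ((3 * ‖Z - Z'‖) ^ holderExponent l n m q)) := by
        gcongr
        · exact hK Z hZ _ (by positivity)
        · exact (lintegral_mono_set hball).trans (hK Z' hZ' _ (by positivity))
    _ = _ := by
        rw [← mul_add, ← ENNReal.ofReal_add (by positivity) (by positivity),
          Real.mul_rpow two_pos.le hδ.le, Real.mul_rpow three_pos.le hδ.le, ← add_mul,
          ENNReal.ofReal_mul (by positivity), ENNReal.coe_mul, ENNReal.coe_mul,
          ENNReal.coe_rpow_of_ne_zero two_ne_zero, ← ENNReal.ofReal.eq_1, ENNReal.coe_ofNat]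
        ring

theorem exists_setLIntegral_Ici_Δ_le (c : Idx l n m → ℂ) (hq1 : 1 < q)
    (hE : 0 < holderExponent l n m q) :
    ∃ K : NNReal, ∀ Z ∈ MN l n m, ∀ Z' ∈ MN l n m, Z ≠ Z' →
      ∫⁻ Θ in (‖· - Z‖) ⁻¹' Ici (2 * ‖Z - Z'‖), ENNReal.ofReal (Δ c Θ Z Z') ^ q
          ∂weightedVolume l n m q
        ≤ K * ENNReal.ofReal (‖Z - Z'‖ ^ holderExponent l n m q) := by
  obtain ⟨K, hK⟩ := exists_setLIntegral_shell_Δ_le c hq1.le (lt_two_of_holderExponent_pos hE)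
  set e : ℝ := (2 * ((l + n + m : ℕ) : ℝ) + 4) * (1 - q) with he
  have he0 : e < 0 := mul_neg_of_pos_of_neg (by positivity) (sub_neg.2 hq1)
  have h2e : 0 ≤ (1 - (2 : ℝ) ^ e)⁻¹ :=
    inv_nonneg.2 (sub_nonneg.2 (Real.rpow_lt_one_of_one_lt_of_neg one_lt_two he0).le)
  refine ⟨K * ((2 : ℝ) ^ e * (1 - 2 ^ e)⁻¹).toNNReal, fun Z hZ Z' hZ' hZZ' => ?_⟩
  have hδ : 0 < ‖Z - Z'‖ := norm_sub_pos_iff.2 hZZ'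
  refine (setLIntegral_preimage_Ici_le_of_shell (by positivity) he0 fun ρ hρ =>
    hK Z hZ Z' hZ' ρ (by linarith) (by linarith)).trans_eq ?_
  have hexp : ‖Z - Z'‖ ^ holderExponent l n m q = ‖Z - Z'‖ ^ q * ‖Z - Z'‖ ^ e := by
    rw [← Real.rpow_add hδ, holderExponent, he]
    ring_nf
  rw [hexp, Real.mul_rpow two_pos.le hδ.le, mul_right_comm (2 ^ e), ENNReal.coe_mul,
    ← ENNReal.ofReal.eq_1,
    ENNReal.ofReal_mul (p := 2 ^ e * (1 - 2 ^ e)⁻¹) (by positivity),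
    ENNReal.ofReal_mul (p := ‖Z - Z'‖ ^ q) (by positivity)]
  ring

theorem exists_nat_one_le_mul_two_pow {δ : ℝ} (hδ : 0 < δ) :
    ∃ M : ℕ, 1 ≤ δ * 2 ^ M ∧ (M : ℝ) ≤ 2 * (1 + |Real.log δ|) := by
  have hlog2 : 0 < Real.log 2 := Real.log_pos one_lt_two
  refine ⟨⌈|Real.log δ| / Real.log 2⌉₊, ?_, ?_⟩
  · rw [← Real.log_nonneg_iff (by positivity), Real.log_mul hδ.ne' (by positivity), Real.log_pow]
    linarith [neg_abs_le (Real.log δ),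
      (div_le_iff₀ hlog2).1 (Nat.le_ceil (|Real.log δ| / Real.log 2))]
  · have hdiv : |Real.log δ| / Real.log 2 ≤ 2 * |Real.log δ| := by
      rw [div_le_iff₀ hlog2]
      nlinarith [abs_nonneg (Real.log δ), Real.log_two_gt_d9]
    linarith [Nat.ceil_lt_add_one (a := |Real.log δ| / Real.log 2) (by positivity)]

theorem exists_setLIntegral_Ici_Δ_le_log (c : Idx l n m → ℂ) :
    ∃ K : NNReal, ∀ Z ∈ MN l n m, ∀ Z' ∈ MN l n m, Z ≠ Z' →
      ∫⁻ Θ in (‖· - Z‖) ⁻¹' Ici (2 * ‖Z - Z'‖), ENNReal.ofReal (Δ c Θ Z Z') ^ (1 : ℝ)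
          ∂weightedVolume l n m 1
        ≤ K * ENNReal.ofReal (‖Z - Z'‖ * (1 + |Real.log ‖Z - Z'‖|)) := by
  obtain ⟨K, hK⟩ := exists_setLIntegral_shell_Δ_le c le_rfl one_lt_two
  refine ⟨K * 2, fun Z hZ Z' hZ' hZZ' => ?_⟩
  have hδ : 0 < ‖Z - Z'‖ := norm_sub_pos_iff.2 hZZ'
  obtain ⟨M, hM, hMlog⟩ := exists_nat_one_le_mul_two_pow hδ
  have hrange : (‖· - Z‖) ⁻¹' Ici (2 * ‖Z - Z'‖)
      ≤ᵐ[weightedVolume l n m 1] (‖· - Z‖) ⁻¹' Ico (2 * ‖Z - Z'‖) (2 * ‖Z - Z'‖ * 2 ^ M) := by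
    filter_upwards [ae_mem_MN_weightedVolume (l := l) (n := n) (m := m) 1] with Θ hΘ hΘZ
    exact ⟨hΘZ, by linarith [norm_sub_lt_two hΘ hZ]⟩
  calc _ ≤ ∫⁻ Θ in (‖· - Z‖) ⁻¹' Ico (2 * ‖Z - Z'‖) (2 * ‖Z - Z'‖ * 2 ^ M),
          ENNReal.ofReal (Δ c Θ Z Z') ^ (1 : ℝ) ∂weightedVolume l n m 1 :=
        lintegral_mono_set' hrange
    _ ≤ M * (K * ENNReal.ofReal ‖Z - Z'‖) := by
        refine setLIntegral_preimage_Ico_le_of_shell (by positivity) M fun ρ hρ => ?_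
        simpa using hK Z hZ Z' hZ' ρ (by linarith) (by linarith)
    _ = K * ENNReal.ofReal (‖Z - Z'‖ * M) := by
        rw [ENNReal.ofReal_mul hδ.le, ENNReal.ofReal_natCast]
        ring
    _ ≤ K * ENNReal.ofReal (2 * (‖Z - Z'‖ * (1 + |Real.log ‖Z - Z'‖|))) := by
        rw [mul_left_comm 2]
        gcongr
    _ = _ := by
        rw [ENNReal.ofReal_mul two_pos.le, ENNReal.ofReal_ofNat, ENNReal.coe_mul, mul_assoc,
          ENNReal.coe_ofNat]

theorem exists_lintegral_Δ_rpow_le_of_ball_of_Ici {c : Idx l n m → ℂ} (hq : 0 < q) {b : ℝ → ℝ}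
    (hball : ∃ K : NNReal, ∀ Z ∈ MN l n m, ∀ Z' ∈ MN l n m, Z ≠ Z' →
      ∫⁻ Θ in ball Z (2 * ‖Z - Z'‖), ENNReal.ofReal (Δ c Θ Z Z') ^ q ∂weightedVolume l n m q
        ≤ K * ENNReal.ofReal (b ‖Z - Z'‖))
    (hIci : ∃ K : NNReal, ∀ Z ∈ MN l n m, ∀ Z' ∈ MN l n m, Z ≠ Z' →
      ∫⁻ Θ in (‖· - Z‖) ⁻¹' Ici (2 * ‖Z - Z'‖), ENNReal.ofReal (Δ c Θ Z Z') ^ q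
        ∂weightedVolume l n m q ≤ K * ENNReal.ofReal (b ‖Z - Z'‖)) :
    ∃ C : ℝ, 0 < C ∧ ∀ Z ∈ MN l n m, ∀ Z' ∈ MN l n m,
      ∫⁻ Θ, ENNReal.ofReal (Δ c Θ Z Z') ^ q ∂weightedVolume l n m q
        ≤ ENNReal.ofReal (C * b ‖Z - Z'‖) := by
  obtain ⟨K₁, hK₁⟩ := hball
  obtain ⟨K₂, hK₂⟩ := hIci
  refine ⟨K₁ + K₂ + 1, by positivity, fun Z hZ Z' hZ' => ?_⟩
  obtain rfl | hZZ' := eq_or_ne Z Z'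
  · simp [Δ_self, hq]
  have hcover : ball Z (2 * ‖Z - Z'‖) ∪ (‖· - Z‖) ⁻¹' Ici (2 * ‖Z - Z'‖) = univ :=
    eq_univ_of_forall fun Θ => (lt_or_ge ‖Θ - Z‖ (2 * ‖Z - Z'‖)).imp_left mem_ball_iff_norm.2
  calc ∫⁻ Θ, ENNReal.ofReal (Δ c Θ Z Z') ^ q ∂weightedVolume l n m q
      ≤ K₁ * ENNReal.ofReal (b ‖Z - Z'‖) + K₂ * ENNReal.ofReal (b ‖Z - Z'‖) := by
        rw [← setLIntegral_univ, ← hcover]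
        exact (lintegral_union_le _ _ _).trans
          (add_le_add (hK₁ Z hZ Z' hZ' hZZ') (hK₂ Z hZ Z' hZ' hZZ'))
    _ = ENNReal.ofReal (K₁ + K₂) * ENNReal.ofReal (b ‖Z - Z'‖) := by
        rw [← NNReal.coe_add, ENNReal.ofReal_coe_nnreal, ENNReal.coe_add, add_mul]
    _ ≤ ENNReal.ofReal (K₁ + K₂ + 1) * ENNReal.ofReal (b ‖Z - Z'‖) := by
        gcongr ENNReal.ofReal ?_ * _
        exact le_add_of_nonneg_right zero_le_one
    _ = _ := (ENNReal.ofReal_mul (by positivity)).symm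

theorem exists_lintegral_Δ_rpow_le (c : Idx l n m → ℂ) (hq1 : 1 < q)
    (hE : 0 < holderExponent l n m q) :
    ∃ C : ℝ, 0 < C ∧ ∀ Z ∈ MN l n m, ∀ Z' ∈ MN l n m,
      ∫⁻ Θ, ENNReal.ofReal (Δ c Θ Z Z') ^ q ∂weightedVolume l n m q
        ≤ ENNReal.ofReal (C * ‖Z - Z'‖ ^ holderExponent l n m q) :=
  exists_lintegral_Δ_rpow_le_of_ball_of_Ici (b := (· ^ holderExponent l n m q)) (by positivity)
    (exists_setLIntegral_ball_Δ_le c hq1.le hE) (exists_setLIntegral_Ici_Δ_le c hq1 hE)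

theorem exists_lintegral_Δ_le_log (c : Idx l n m → ℂ) :
    ∃ C : ℝ, 0 < C ∧ ∀ Z ∈ MN l n m, ∀ Z' ∈ MN l n m,
      ∫⁻ Θ, ENNReal.ofReal (Δ c Θ Z Z') ^ (1 : ℝ) ∂weightedVolume l n m 1
        ≤ ENNReal.ofReal (C * (‖Z - Z'‖ * (1 + |Real.log ‖Z - Z'‖|))) := by
  obtain ⟨K, hK⟩ :=
    exists_setLIntegral_ball_Δ_le c le_rfl (one_pos.trans_eq holderExponent_one.symm)
  refine exists_lintegral_Δ_rpow_le_of_ball_of_Ici (b := fun δ => δ * (1 + |Real.log δ|)) one_pos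
    ⟨K, fun Z hZ Z' hZ' hZZ' => (hK Z hZ Z' hZ' hZZ').trans ?_⟩
    (exists_setLIntegral_Ici_Δ_le_log c)
  rw [holderExponent_one, Real.rpow_one]
  gcongr
  exact le_mul_of_one_le_right (norm_nonneg _) (le_add_of_nonneg_right (abs_nonneg _))

end Integrals

end MartinelliBochner

end

theorem theorem7p2_general (l n m : ℕ) (c : MartinelliBochner.Idx l n m → ℂ) (q : ℝ) (hq1 : 1 ≤ q)
    (hq : q < (2 * ((l + n + m : ℕ) : ℝ) + 4) / (2 * ((l + n + m : ℕ) : ℝ) + 3)) :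
    ∃ C : ℝ, 0 < C ∧
      ∀ Z ∈ MartinelliBochner.MN l n m, ∀ Z' ∈ MartinelliBochner.MN l n m,
        (1 < q →
          ∫⁻ Θ in MartinelliBochner.MN l n m,
              ENNReal.ofReal (MartinelliBochner.Δ c Θ Z Z' ^ q
                * MartinelliBochner.wt Θ ^ (2 * (q - 1))) ∂(MartinelliBochner.dV l n m)
            ≤ ENNReal.ofReal (C * ‖Z - Z'‖ ^ (2 * ((l + n + m : ℕ) : ℝ) + 4
                - (2 * ((l + n + m : ℕ) : ℝ) + 3) * q))) ∧
        (q = 1 →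
          ∫⁻ Θ in MartinelliBochner.MN l n m,
              ENNReal.ofReal (MartinelliBochner.Δ c Θ Z Z' ^ q
                * MartinelliBochner.wt Θ ^ (2 * (q - 1))) ∂(MartinelliBochner.dV l n m)
            ≤ ENNReal.ofReal (C * (‖Z - Z'‖ * (1 + |Real.log ‖Z - Z'‖|)))) := by
  simp only [MartinelliBochner.setLIntegral_MN_ofReal_Δ_rpow_mul c (zero_le_one.trans hq1)]
  obtain rfl | hq1 := hq1.eq_or_lt
  · obtain ⟨C, hC, hle⟩ := MartinelliBochner.exists_lintegral_Δ_le_log c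
    exact ⟨C, hC, fun Z hZ Z' hZ' => ⟨fun h => absurd h (lt_irrefl 1), fun _ => hle Z hZ Z' hZ'⟩⟩
  · obtain ⟨C, hC, hle⟩ :=
      MartinelliBochner.exists_lintegral_Δ_rpow_le c hq1 (MartinelliBochner.holderExponent_pos hq)
    exact ⟨C, hC, fun Z hZ Z' hZ' => ⟨fun _ => hle Z hZ Z' hZ', fun h => absurd h hq1.ne'⟩⟩

theorem theorem7p2 (l n m : ℕ) (hl : 1 ≤ l) (hn : 2 ≤ n) (hm : 2 ≤ m)
    (c : MartinelliBochner.Idx l n m → ℂ) (q : ℝ) (hq1 : 1 ≤ q)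
    (hq : q < (2 * ((l + n + m : ℕ) : ℝ) + 4) / (2 * ((l + n + m : ℕ) : ℝ) + 3)) :
    ∃ C : ℝ, 0 < C ∧
      ∀ Z ∈ MartinelliBochner.MN l n m, ∀ Z' ∈ MartinelliBochner.MN l n m,
        (1 < q →
          ∫⁻ Θ in MartinelliBochner.MN l n m,
              ENNReal.ofReal (MartinelliBochner.Δ c Θ Z Z' ^ q
                * MartinelliBochner.wt Θ ^ (2 * (q - 1))) ∂(MartinelliBochner.dV l n m)
            ≤ ENNReal.ofReal (C * ‖Z - Z'‖ ^ (2 * ((l + n + m : ℕ) : ℝ) + 4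
                - (2 * ((l + n + m : ℕ) : ℝ) + 3) * q))) ∧
        (q = 1 →
          ∫⁻ Θ in MartinelliBochner.MN l n m,
              ENNReal.ofReal (MartinelliBochner.Δ c Θ Z Z' ^ q
                * MartinelliBochner.wt Θ ^ (2 * (q - 1))) ∂(MartinelliBochner.dV l n m)
            ≤ ENNReal.ofReal (C * (‖Z - Z'‖ * (1 + |Real.log ‖Z - Z'‖|)))) :=
  theorem7p2_general l n m c q hq1 hq
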